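/- Let $1<\alpha<2$. For $u:\mathbb R\to\mathbb R$ (for a function $u(x,t)$, read $u=u(\cdot,t)$ with $t$ fixed) the Riesz derivative of order $\alpha$ is $$\frac{\partial^\alpha u}{\partial|x|^\alpha}(x)=-\frac{1}{2\cos(\pi\alpha/2)\,\Gamma(2-\alpha)}\,\frac{d^2}{dx^2}\int_{\mathbb R}\frac{u(\eta)}{|x-\eta|^{\alpha-1}}\,d\eta .$$ For $h>0$ and $\ell\ge 0$ put $$\Delta_h^\alpha u(x)=\sum_{k\in\mathbb Z}g_k^{(\alpha)}u(x-kh),\quad g_k^{(\alpha)}=\frac{(-1)^k\,\Gamma(\alpha+1)}{\Gamma(\frac\alpha2-k+1)\,\Gamma(\frac\alpha2+k+1)},\qquad \delta_x^{2\ell}v(x)=\sum_{s=0}^{2\ell}(-1)^s\binom{2\ell}{s}v(x+(\ell-s)h).$$ Then the following holds. (a) There is exactly one sequence $(a_p)_{p\ge 0}$ of real numbers with $\left|\frac{2\sin(\theta/2)}{\theta}\right|^\alpha=\sum_{p=0}^\infty a_p|\theta|^{2p}$ for all $\theta\ne 0$ near $0$; moreover $a_0=1$, $a_1=-\frac{\alpha}{24}$,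 $a_2=\left(\frac1{1920}+\frac{\alpha-1}{1152}\right)\alpha$, $a_3=-\left(\frac1{322560}+\frac{\alpha-1}{46080}+\frac{(\alpha-1)(\alpha-2)}{82944}\right)\alpha$. (b) There is a sequence $(b_\ell)_{\ell\ge0}$ of real numbers (depending only on $\alpha$) such that for every $n\ge 2$ the numbers $b_0,\dots,b_{n-1}$ are the only solution of the following identity in $\theta\in\mathbb R$ (where $\theta$ stands for $\omega h$): $$\sum_{\ell=0}^{n-2}b_\ell\Biggl(2\sum_{s=0}^{\ell-1}\sum_{q=0}^{n-1}\sum_{p=0}^{n-1-q}\frac{(-1)^{s+q}(\ell-s)^{2q}\binom{2\ell}{s}a_p}{(2q)!}|\theta|^{2(p+q)}+(-1)^\ell\binom{2\ell}{\ell}\sum_{p=0}^{n-1}a_p|\theta|^{2p}\Biggr)$$ $$=1-b_{n-1}\Biggl(\sum_{s=0}^{n-2}(-1)^s\binom{2n-2}{s}\frac{2(n-1-s)^{2n-2}}{(2n-2)!}\Biggr)(-1)^{n-1}|\theta|^{2n-2}.$$ Moreover $b_0=1$, $b_1=-\frac\alpha{24}$, $b_2=\left(\frac{11}{2880}+\frac{\alpha}{1152}\right)\alpha$,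 $b_3=-\left(\frac{191}{362880}+\frac{11\alpha}{69120}+\frac{\alpha^2}{82944}\right)\alpha$, $b_4=\left(\frac{2497}{29030400}+\frac{10181\alpha}{348364800}+\frac{11\alpha^2}{3317760}+\frac{\alpha^3}{7962624}\right)\alpha$. (c) For every $n\ge2$ and $h>0$ the operator $\delta_x^0-b_{n-1}\delta_x^{2n-2}$ is a bijection of the space of bounded functions $\mathbb R\to\mathbb R$ onto itself; $(\delta_x^0-b_{n-1}\delta_x^{2n-2})^{-1}$ denotes its inverse there. (d) Let $n\ge1$ and let $u\in C^{[\alpha]+2n+1}(\mathbb R)$ be such that all derivatives of $u$ of orders $0,\dots,[\alpha]+2n+2$ exist on $\mathbb R$ and belong to $L^1(\mathbb R)$. Then the integral defining the Riesz derivative converges absolutely for all $x$ and is a $C^2$ function of $x$, and the series for $\Delta_h^\alpha u(x)$ converges absolutely for all $h>0$ and $x$. If $n\ge2$, then $\left(\sum_{\ell=0}^{n-2}b_\ell\,\delta_x^{2\ell}\right)\left(-\frac{\Delta_h^\alpha u}{h^\alpha}\right)$ is bounded on $\mathbb R$ for every $h>0$, and $$\frac{\partial^\alpha u}{\partial|x|^\alpha}(x)=\left(\delta_x^0-b_{n-1}\delta_x^{2n-2}\right)^{-1}\left(\sum_{\ell=0}^{n-2}b_\ell\,\delta_x^{2\ell}\right)\left(-\frac{\Delta_h^\alpha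 u}{h^\alpha}\right)(x)+\mathcal O(h^{2n}),$$ while for $n=1$ $$\frac{\partial^\alpha u}{\partial|x|^\alpha}(x)=-\frac{\Delta_h^\alpha u(x)}{h^\alpha}+\mathcal O(h^{2}).$$ Here $\mathcal O(h^{2n})$ is a term of absolute value at most $Ch^{2n}$ for all $h>0$ and all $x\in\mathbb R$, with $C$ independent of $h$ and $x$. For $n=2,3,4,5$, with the values of $b_0,\dots,b_4$ in (b), these are fractional-compact formulas of orders 4, 6, 8 and 10. -/

import Mathlib

open scoped Topology

noncomputable section

namespace RieszCompact

/-- The constant `κ_α = (1/2) sec (π α / 2)`. -/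
def kappa (α : ℝ) : ℝ := 1 / (2 * Real.cos (Real.pi * α / 2))

/-- The integral `∫_ℝ u(η) / |x - η|^(α - 1) dη` as a function of `x`. -/
def singularIntegral (α : ℝ) (u : ℝ → ℝ) (x : ℝ) : ℝ :=
  ∫ η : ℝ, u η / |x - η| ^ (α - 1)

/-- The Riesz derivative of order `α ∈ (1,2)`:
`- κ_α / Γ(2 - α) * d²/dx² ∫_ℝ u(η) / |x - η|^(α - 1) dη`. -/
def rieszDeriv (α : ℝ) (u : ℝ → ℝ) (x : ℝ) : ℝ :=
  -(kappa α / Real.Gamma (2 - α)) * iteratedDeriv 2 (singularIntegral α u) x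

/-- The coefficients `g_k^(α)` of the fractional centred difference, `k ∈ ℤ`. -/
def gCoeff (α : ℝ) (k : ℤ) : ℝ :=
  (-1 : ℝ) ^ k * Real.Gamma (α + 1) /
    (Real.Gamma (α / 2 - (k : ℝ) + 1) * Real.Gamma (α / 2 + (k : ℝ) + 1))

/-- The fractional centred difference `Δ_h^α u(x) = ∑_{k ∈ ℤ} g_k^(α) u(x - k h)`. -/
def fracDiff (α h : ℝ) (u : ℝ → ℝ) (x : ℝ) : ℝ :=
  ∑' k : ℤ, gCoeff α k * u (x - (k : ℝ) * h)

/-- The central difference `δ_x^{2ℓ}` with step `h`: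
`δ_x^{2ℓ} v(x) = ∑_{s=0}^{2ℓ} (-1)^s binom(2ℓ, s) v(x + (ℓ - s) h)`. -/
def centralDiff (h : ℝ) (l : ℕ) (v : ℝ → ℝ) (x : ℝ) : ℝ :=
  ∑ s ∈ Finset.range (2 * l + 1),
    (-1 : ℝ) ^ s * ((2 * l).choose s : ℝ) * v (x + ((l : ℝ) - (s : ℝ)) * h)

/-- The operator `δ_x^0 - b_{n-1} δ_x^{2n-2}`. -/
def compactOp (n : ℕ) (b : ℕ → ℝ) (h : ℝ) (v : ℝ → ℝ) : ℝ → ℝ := fun x =>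
  centralDiff h 0 v x - b (n - 1) * centralDiff h (n - 1) v x

/-- The operator `∑_{ℓ=0}^{n-2} b_ℓ δ_x^{2ℓ}`. -/
def explicitOp (n : ℕ) (b : ℕ → ℝ) (h : ℝ) (v : ℝ → ℝ) : ℝ → ℝ := fun x =>
  ∑ l ∈ Finset.range (n - 1), b l * centralDiff h l v x

/-- The bounded functions on the real line. -/
def boundedFun : Set (ℝ → ℝ) := {v | ∃ M : ℝ, ∀ x, |v x| ≤ M}

/-- The inverse of `δ_x^0 - b_{n-1} δ_x^{2n-2}` on the space of bounded functions (the genuine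
inverse as soon as that operator is a bijection of this space onto itself). -/
def compactInv (n : ℕ) (b : ℕ → ℝ) (h : ℝ) : (ℝ → ℝ) → (ℝ → ℝ) :=
  Function.invFunOn (compactOp n b h) boundedFun

/-- `a` is the sequence of coefficients of the expansion
`∑_p a_p |θ|^{2p} = |2 sin(θ/2) / θ|^α` for `θ ≠ 0` near `0`; here `θ` stands for `ω h`. -/
def IsSincExpansion (α : ℝ) (a : ℕ → ℝ) : Prop :=
  ∀ᶠ θ : ℝ in 𝓝[≠] 0,
    HasSum (fun p : ℕ => a p * |θ| ^ (2 * p)) (|2 * Real.sin (θ / 2) / θ| ^ α)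

/-- The matching equation for `b_0, …, b_{n-1}`, as an identity of polynomials in `θ = ω h`. -/
def IsCompactCoeff (a : ℕ → ℝ) (n : ℕ) (b : ℕ → ℝ) : Prop :=
  ∀ θ : ℝ,
    ∑ l ∈ Finset.range (n - 1), b l *
      (2 * ∑ s ∈ Finset.range l, ∑ q ∈ Finset.range n, ∑ p ∈ Finset.range (n - q),
          (-1 : ℝ) ^ (s + q) * ((l : ℝ) - (s : ℝ)) ^ (2 * q) * ((2 * l).choose s : ℝ) * a p
            / ((2 * q).factorial : ℝ) * |θ| ^ (2 * (p + q))
        + (-1 : ℝ) ^ l * ((2 * l).choose l : ℝ) *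
          ∑ p ∈ Finset.range n, a p * |θ| ^ (2 * p))
    = 1 - b (n - 1) *
        (∑ s ∈ Finset.range (n - 1), (-1 : ℝ) ^ s * ((2 * n - 2).choose s : ℝ) *
          (2 * ((n : ℝ) - 1 - (s : ℝ)) ^ (2 * n - 2) / ((2 * n - 2).factorial : ℝ))) *
        (-1 : ℝ) ^ (n - 1) * |θ| ^ (2 * n - 2)

end RieszCompact

end

open RieszCompact

/-! On the Fourier side every operator is a multiplier. With θ = 2πωh, `δ_x^2` has symbol 2cos θ - 2
= -4 sin²(θ/2), the Riesz derivative has symbol -h^(-α)|θ|^α, and -Δ_h^α/h^α has symbol -h^(-α)|2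
sin(θ/2)|^α. The formula has order 2n when the sum of b_ℓ (2cos θ - 2)^ℓ over ℓ < n, times |2
sin(θ/2)/θ|^α, is 1 + O(|θ|^(2n)).

Put z = sin(θ/2). Then θ/(2 sin(θ/2)) = arcsin z / z, so the condition asks for the expansion of
(arcsin z / z)^α in powers of -4z². Hence b_ℓ = (-1/4)^ℓ c_ℓ, where c_ℓ is the coefficient of z^(2ℓ)
in (arcsin z / z)^α (`substSinSq_arcsinPowSeries_mul`, `sum_compactCoeff_dvd`). Uniqueness holds
because the ℓ-th power of the symbol starts at θ^(2ℓ), which makes the system triangular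
(`isCompactCoeff_iff`).

Since `δ_x^{2ℓ}` has sup norm at most 4^ℓ and |b_ℓ| 4^ℓ = c_ℓ, a Neumann series inverts the compact
operator once c_ℓ < 1 for ℓ ≥ 1. Kaluza's criterion gives the logarithmic derivative of arcsin z / z
nonnegative coefficients. So c_ℓ increases with α, and the square (arcsin z / z)² settles the matter
(`arcsinPowCoeff_lt_one`).

The symbols come from two computations. The g_k are the Fourier coefficients of |2 sin(θ/2)|^α
(`hasSum_gCoeff_mul_exp`), and the Riesz potential is diagonalised by writing powers as
superpositions of Gaussians (`IsFourierInt.riesz_potential`). The symbol error is at most a constant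
times |θ|^(2n+α) for all θ (`symbol_bound`). Integrated against the decaying transform of u it
yields O(h^(2n)) (`error_bound`), and the bounded inverse carries this to the solution
(`abs_sub_compactInv_le`). -/

noncomputable section

/-! ### Formal power series: arcsin z / z after the substitution z = sin(θ/2). -/

namespace RieszCompact

open PowerSeries

/-- The coefficients of `(1 - w)^(-1/2)`. -/
def invSqrtCoeff : ℕ → ℝ
  | 0 => 1
  | n + 1 => invSqrtCoeff n * ((2 * n + 1) / (2 * n + 2))

/-- The power series of `(1 - w)^(-1/2)`. -/
def invSqrtSeries : ℝ⟦X⟧ := mk invSqrtCoeff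

/-- The power series in `w = z^2` of `arcsin z / z`. -/
def arcsinSeries : ℝ⟦X⟧ := mk fun n => invSqrtCoeff n / (2 * n + 1)

/-- The power series in `x = θ^2` of `2 sin (θ / 2) / θ`. -/
def sincSeries : ℝ⟦X⟧ := mk fun p => (-1) ^ p / (4 ^ p * (2 * p + 1).factorial)

/-- The power series in `x = θ^2` of `cos (r θ)`. -/
def cosSeries (r : ℝ) : ℝ⟦X⟧ := mk fun q => (-1) ^ q * r ^ (2 * q) / (2 * q).factorial

/-- The power series in `x = θ^2` of `sin (θ / 2) ^ 2`. -/
def sinSqSeries : ℝ⟦X⟧ := 1 - cosSeries (1 / 2) ^ 2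

lemma invSqrtCoeff_pos (n : ℕ) : 0 < invSqrtCoeff n := by
  induction n with
  | zero => simp [invSqrtCoeff]
  | succ n ih => rw [invSqrtCoeff]; positivity

lemma constantCoeff_arcsinSeries : constantCoeff arcsinSeries = 1 := by
  rw [← coeff_zero_eq_constantCoeff_apply]; simp [arcsinSeries, invSqrtCoeff]

lemma constantCoeff_sincSeries : constantCoeff sincSeries = 1 := by
  rw [← coeff_zero_eq_constantCoeff_apply]; simp [sincSeries]

lemma constantCoeff_cosSeries (r : ℝ) : constantCoeff (cosSeries r) = 1 := by
  rw [← coeff_zero_eq_constantCoeff_apply]; simp [cosSeries]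

lemma constantCoeff_sinSqSeries : constantCoeff sinSqSeries = 0 := by
  simp [sinSqSeries, constantCoeff_cosSeries]

lemma eq_of_derivative_eq_zero {f : ℝ⟦X⟧} {r : ℝ} (h : d⁄dX ℝ f = 0)
    (h0 : constantCoeff f = r) : f = C r := by
  refine derivative.ext ?_ ?_
  · rw [h, derivative_C]
  · simpa using h0

lemma two_mul_natCast_coeff (n : ℕ) (f : ℝ⟦X⟧) : coeff n (2 * f) = 2 * coeff n f := by
  rw [two_mul, map_add, two_mul]

lemma coeff_X_mul_derivative (n : ℕ) (f : ℝ⟦X⟧) :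
    coeff n (X * d⁄dX ℝ f) = n * coeff n f := by
  cases n with
  | zero => simp
  | succ n => rw [coeff_succ_X_mul, coeff_derivative]; push_cast; ring

lemma derivative_invSqrtSeries :
    2 * (1 - X) * d⁄dX ℝ invSqrtSeries = invSqrtSeries := by
  ext n
  rw [mul_assoc, two_mul_natCast_coeff, sub_mul, one_mul, map_sub, coeff_X_mul_derivative,
    coeff_derivative]
  simp only [invSqrtSeries, coeff_mk, invSqrtCoeff]
  field_simp
  ring

/-- With arcsin z = z A(z²), this is d/dz arcsin z = (1 - z²)^(-1/2). In the variable w = z² the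
operator d/dz z becomes 2w d/dw + 1. -/
lemma derivative_arcsinSeries :
    2 * (X * d⁄dX ℝ arcsinSeries) + arcsinSeries = invSqrtSeries := by
  ext n
  rw [map_add, two_mul_natCast_coeff, coeff_X_mul_derivative]
  simp only [invSqrtSeries, arcsinSeries, coeff_mk]
  field_simp

lemma derivative_sincSeries :
    2 * (X * d⁄dX ℝ sincSeries) + sincSeries = cosSeries (1 / 2) := by
  ext n
  rw [map_add, two_mul_natCast_coeff, coeff_X_mul_derivative]
  simp only [sincSeries, cosSeries, coeff_mk, Nat.factorial_succ, pow_mul]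
  push_cast
  rw [show ((1 : ℝ) / 2) ^ 2 = 1 / 4 by norm_num, div_pow, one_pow]
  field_simp

lemma derivative_cosSeries_half :
    8 * d⁄dX ℝ (cosSeries (1 / 2)) = -sincSeries := by
  ext n
  rw [← map_ofNat (C (R := ℝ)) 8, coeff_C_mul, coeff_derivative, map_neg]
  simp only [sincSeries, cosSeries, coeff_mk, pow_mul]
  rw [show 2 * (n + 1) = 2 * n + 1 + 1 by ring, Nat.factorial_succ (2 * n + 1),
    show ((1 : ℝ) / 2) ^ 2 = 1 / 4 by norm_num, div_pow, one_pow]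
  push_cast
  field_simp
  ring

lemma four_mul_derivative_sinSqSeries :
    4 * d⁄dX ℝ sinSqSeries = cosSeries (1 / 2) * sincSeries := by
  rw [sinSqSeries, map_sub, derivative_one, pow_two, Derivation.leibniz]
  simp only [smul_eq_mul]
  linear_combination (-cosSeries (1 / 2)) * derivative_cosSeries_half

lemma four_mul_sinSqSeries : 4 * sinSqSeries = X * sincSeries ^ 2 := by
  have key : X * sincSeries ^ 2 - 4 * sinSqSeries = C 0 := by
    refine eq_of_derivative_eq_zero ?_ (by simp [constantCoeff_sinSqSeries])
    have h4 : d⁄dX ℝ (4 * sinSqSeries) = 4 * d⁄dX ℝ sinSqSeries := by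
      rw [← map_ofNat (C (R := ℝ)) 4, Derivation.leibniz, derivative_C]
      simp
    rw [map_sub, h4, four_mul_derivative_sinSqSeries, pow_two, Derivation.leibniz,
      Derivation.leibniz, derivative_X]
    simp only [smul_eq_mul]
    linear_combination sincSeries * derivative_sincSeries
  rw [map_zero] at key
  linear_combination -key

lemma hasSubst_sinSqSeries : HasSubst sinSqSeries :=
  HasSubst.of_constantCoeff_zero' constantCoeff_sinSqSeries

/-- Substitution of `sin (θ / 2) ^ 2` into a power series. -/
def substSinSq : ℝ⟦X⟧ →ₐ[ℝ] ℝ⟦X⟧ := substAlgHom hasSubst_sinSqSeries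

lemma substSinSq_X : substSinSq X = sinSqSeries := substAlgHom_X hasSubst_sinSqSeries

lemma derivative_substSinSq (f : ℝ⟦X⟧) :
    d⁄dX ℝ (substSinSq f) = substSinSq (d⁄dX ℝ f) * d⁄dX ℝ sinSqSeries := by
  simp only [substSinSq, coe_substAlgHom]
  exact derivative_subst hasSubst_sinSqSeries

lemma constantCoeff_substSinSq (f : ℝ⟦X⟧) :
    constantCoeff (substSinSq f) = constantCoeff f := by
  obtain ⟨g, hg⟩ : ∃ g, f = g * X + C (constantCoeff f) := ⟨_, f.eq_shift_mul_X_add_const⟩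
  have hC : substSinSq (C (constantCoeff f)) = C (constantCoeff f) := by
    have := substSinSq.commutes (constantCoeff f)
    simpa [PowerSeries.algebraMap_apply] using this
  conv_lhs => rw [hg]
  rw [map_add, map_mul, substSinSq_X, hC]
  simp [constantCoeff_sinSqSeries]

/-- Formal version of (1 - sin²(θ/2))^(-1/2) = 1/cos(θ/2). The differential equations of the two
factors make the derivative of the product vanish, and its constant term is 1. -/
lemma cosSeries_mul_substSinSq_invSqrtSeries :
    cosSeries (1 / 2) * substSinSq invSqrtSeries = 1 := by
  have h1 := congrArg substSinSq derivative_invSqrtSeries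
  rw [map_mul, map_mul, map_sub, map_one, substSinSq_X, map_ofNat] at h1
  rw [← map_one (C (R := ℝ))]
  refine eq_of_derivative_eq_zero ?_ ?_
  · rw [Derivation.leibniz, derivative_substSinSq]
    simp only [smul_eq_mul]
    have h8 : (8 : ℝ⟦X⟧) ≠ 0 := by
      rw [← map_ofNat (C (R := ℝ)) 8]; simp
    refine mul_left_cancel₀ h8 ?_
    have hs : 1 - sinSqSeries = cosSeries (1 / 2) ^ 2 := by rw [sinSqSeries]; ring
    rw [hs] at h1
    linear_combination 2 * cosSeries (1 / 2) * substSinSq (d⁄dX ℝ invSqrtSeries) *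
      four_mul_derivative_sinSqSeries + substSinSq invSqrtSeries * derivative_cosSeries_half
      + sincSeries * h1
  · rw [map_mul, constantCoeff_substSinSq, constantCoeff_cosSeries,
      ← coeff_zero_eq_constantCoeff_apply]
    simp [invSqrtSeries, invSqrtCoeff]

/-- Formal version of arcsin(sin(θ/2)) = θ/2, divided by sin(θ/2). -/
lemma substSinSq_arcsinSeries_mul_sincSeries : substSinSq arcsinSeries * sincSeries = 1 := by
  set Y := substSinSq arcsinSeries * sincSeries with hY
  have h1 := congrArg substSinSq derivative_arcsinSeries
  rw [map_add, map_mul, map_mul, substSinSq_X, map_ofNat] at h1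
  have hdY : d⁄dX ℝ Y = substSinSq arcsinSeries * d⁄dX ℝ sincSeries +
      sincSeries * (substSinSq (d⁄dX ℝ arcsinSeries) * d⁄dX ℝ sinSqSeries) := by
    rw [hY, Derivation.leibniz, derivative_substSinSq]; simp only [smul_eq_mul]
  -- In terms of θ this says that θ Y(θ²) has derivative 1. The n-th coefficient y_n then satisfies
  -- (2n+1) y_n = δ_{n0}, so Y = 1.
  have key : 2 * (X * d⁄dX ℝ Y) + Y = 1 := by
    have h4 : (2 : ℝ⟦X⟧) ≠ 0 := by
      rw [← map_ofNat (C (R := ℝ)) 2]; simp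
    refine mul_left_cancel₀ h4 ?_
    rw [hdY, hY]
    linear_combination 2 * substSinSq arcsinSeries * derivative_sincSeries +
      X * sincSeries * substSinSq (d⁄dX ℝ arcsinSeries) * four_mul_derivative_sinSqSeries
      - cosSeries (1 / 2) * substSinSq (d⁄dX ℝ arcsinSeries) * four_mul_sinSqSeries
      + 2 * cosSeries (1 / 2) * h1 + 2 * cosSeries_mul_substSinSq_invSqrtSeries
  ext n
  have := congrArg (coeff n) key
  rw [map_add, two_mul_natCast_coeff, coeff_X_mul_derivative] at this
  rw [coeff_one] at this ⊢
  split_ifs at this ⊢ with h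
  · subst h; simpa using this
  · have h2 : (2 * (n : ℝ) + 1) * coeff n Y = 0 := by linear_combination this
    rcases mul_eq_zero.1 h2 with h3 | h3
    · exact absurd h3 (by positivity)
    · exact h3

/-! ### Real powers of arcsin z / z, defined through their differential equation. -/

/-- The logarithmic derivative of `arcsinSeries`. -/
def arcsinLogDeriv : ℝ⟦X⟧ := d⁄dX ℝ arcsinSeries * arcsinSeries⁻¹

lemma arcsinLogDeriv_mul : arcsinLogDeriv * arcsinSeries = d⁄dX ℝ arcsinSeries := by
  rw [arcsinLogDeriv, mul_assoc, PowerSeries.inv_mul_cancel, mul_one]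
  simp [constantCoeff_arcsinSeries]

/-- The coefficients in `w = z^2` of `(arcsin z / z)^α`. -/
def arcsinPowCoeff (α : ℝ) : ℕ → ℝ
  | 0 => 1
  | n + 1 => α / (n + 1) * ∑ k : Fin (n + 1), coeff (n - k) arcsinLogDeriv *
      arcsinPowCoeff α k

/-- The power series in `w = z^2` of `(arcsin z / z)^α`. -/
def arcsinPowSeries (α : ℝ) : ℝ⟦X⟧ := mk (arcsinPowCoeff α)

lemma arcsinPowCoeff_succ (α : ℝ) (n : ℕ) :
    arcsinPowCoeff α (n + 1) = α / (n + 1) * ∑ k ∈ Finset.range (n + 1),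
      coeff (n - k) arcsinLogDeriv * arcsinPowCoeff α k := by
  rw [arcsinPowCoeff, Finset.sum_range]

/-- This equation, read coefficient by coefficient, is the recursion that defines `arcsinPowCoeff`.
It is the only property of the α-th power that is needed. -/
lemma derivative_arcsinPowSeries (α : ℝ) :
    d⁄dX ℝ (arcsinPowSeries α) = C α * (arcsinLogDeriv * arcsinPowSeries α) := by
  ext n
  rw [coeff_derivative, coeff_C_mul, mul_comm arcsinLogDeriv, coeff_mul,
    Finset.Nat.sum_antidiagonal_eq_sum_range_succ_mk]
  simp only [arcsinPowSeries, coeff_mk]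
  rw [arcsinPowCoeff_succ]
  simp_rw [mul_comm (coeff _ arcsinLogDeriv)]
  field_simp

/-- In f' = r f the coefficient of degree n + 1 is determined by the earlier ones. -/
lemma eq_of_derivative_eq_mul {f g r : ℝ⟦X⟧} (hf : d⁄dX ℝ f = r * f) (hg : d⁄dX ℝ g = r * g)
    (h0 : constantCoeff f = constantCoeff g) : f = g := by
  ext n
  induction n using Nat.strong_induction_on with
  | _ n ih =>
    cases n with
    | zero => simpa using h0
    | succ n =>
      have h1 := congrArg (coeff n) hf
      have h2 := congrArg (coeff n) hg
      rw [coeff_derivative, coeff_mul] at h1 h2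
      have : (coeff (n + 1) f - coeff (n + 1) g) * ((n : ℝ) + 1) = 0 := by
        rw [sub_mul, h1, h2, sub_eq_zero]
        refine Finset.sum_congr rfl fun p hp => ?_
        rw [ih p.2 (by have := Finset.HasAntidiagonal.mem_antidiagonal.1 hp; omega)]
      rcases mul_eq_zero.1 this with h | h
      · linarith
      · exact absurd h (by positivity)

lemma arcsinPowSeries_two : arcsinPowSeries 2 = arcsinSeries ^ 2 := by
  refine eq_of_derivative_eq_mul (r := C 2 * arcsinLogDeriv) ?_ ?_ ?_
  · rw [derivative_arcsinPowSeries, mul_assoc]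
  · rw [pow_two, Derivation.leibniz]
    simp only [smul_eq_mul]
    rw [← arcsinLogDeriv_mul, map_ofNat]
    ring
  · rw [map_pow, constantCoeff_arcsinSeries, ← coeff_zero_eq_constantCoeff_apply]
    simp [arcsinPowSeries, arcsinPowCoeff]

/-- The hypothesis `hA` says that `A` is formally the α-th power of `sincSeries`. Since `substSinSq
arcsinSeries` and `sincSeries` are inverse to each other, their logarithmic derivatives cancel
(`h5`). So do those of the α-th powers, and the product is constant. -/
lemma substSinSq_arcsinPowSeries_mul {α : ℝ} {A : ℝ⟦X⟧}
    (hA : sincSeries * d⁄dX ℝ A = C α * (d⁄dX ℝ sincSeries * A))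
    (hA0 : constantCoeff A = 1) : substSinSq (arcsinPowSeries α) * A = 1 := by
  have hC : substSinSq (C α) = C α := by
    have := substSinSq.commutes α
    simpa [PowerSeries.algebraMap_apply] using this
  have h1 := substSinSq_arcsinSeries_mul_sincSeries
  have h2 := congrArg (d⁄dX ℝ) h1
  rw [derivative_one, Derivation.leibniz, derivative_substSinSq] at h2
  simp only [smul_eq_mul] at h2
  have h3 := congrArg substSinSq arcsinLogDeriv_mul
  rw [map_mul] at h3
  have h4 := congrArg substSinSq (derivative_arcsinPowSeries α)
  rw [map_mul, map_mul, hC] at h4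
  have h5 : substSinSq arcsinLogDeriv * d⁄dX ℝ sinSqSeries * sincSeries + d⁄dX ℝ sincSeries = 0 := by
    linear_combination sincSeries * h2 + sincSeries ^ 2 * d⁄dX ℝ sinSqSeries * h3 -
      (d⁄dX ℝ sincSeries + substSinSq arcsinLogDeriv * sincSeries * d⁄dX ℝ sinSqSeries) * h1
  rw [← map_one (C (R := ℝ))]
  refine eq_of_derivative_eq_zero ?_ ?_
  · rw [Derivation.leibniz, derivative_substSinSq]
    simp only [smul_eq_mul]
    have hne : sincSeries ≠ 0 := fun h => by
      have := constantCoeff_sincSeries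
      simp [h] at this
    refine mul_left_cancel₀ hne ?_
    rw [h4]
    linear_combination substSinSq (arcsinPowSeries α) * hA +
      C α * substSinSq (arcsinPowSeries α) * A * h5
  · rw [map_mul, constantCoeff_substSinSq, hA0, ← coeff_zero_eq_constantCoeff_apply]
    simp [arcsinPowSeries, arcsinPowCoeff]

/-! ### Signs and sizes of the coefficients of (arcsin z / z)^α. -/

lemma coeff_arcsinSeries (n : ℕ) : coeff n arcsinSeries = invSqrtCoeff n / (2 * n + 1) := by
  simp [arcsinSeries]

lemma coeff_arcsinSeries_pos (n : ℕ) : 0 < coeff n arcsinSeries := by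
  rw [coeff_arcsinSeries]; have := invSqrtCoeff_pos n; positivity

lemma coeff_arcsinSeries_succ (n : ℕ) : coeff (n + 1) arcsinSeries =
    coeff n arcsinSeries * ((2 * n + 1) ^ 2 / ((2 * n + 2) * (2 * n + 3))) := by
  rw [coeff_arcsinSeries, coeff_arcsinSeries, invSqrtCoeff]
  push_cast
  field_simp
  ring

/-- Ratios of consecutive coefficients increase, so the coefficients of arcsin z / z are log-convex:
the hypothesis of Kaluza's criterion. -/
lemma arcsin_ratio_mono {m n : ℕ} (h : m ≤ n) :
    (2 * (m : ℝ) + 1) ^ 2 / ((2 * m + 2) * (2 * m + 3)) ≤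
      (2 * (n : ℝ) + 1) ^ 2 / ((2 * n + 2) * (2 * n + 3)) := by
  have h' : (m : ℝ) ≤ n := by exact_mod_cast h
  have e : ∀ x : ℝ, 0 ≤ x → (2 * x + 1) ^ 2 / ((2 * x + 2) * (2 * x + 3)) =
      ((2 * x + 1) / (2 * x + 2)) * ((2 * x + 1) / (2 * x + 3)) := by
    intro x hx; field_simp
  rw [e m (by positivity), e n (by positivity)]
  have hm : (0 : ℝ) ≤ m := by positivity
  have hn : (0 : ℝ) ≤ n := by positivity
  have i1 : (2 * (m : ℝ) + 1) / (2 * m + 2) ≤ (2 * n + 1) / (2 * n + 2) := by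
    rw [div_le_div_iff₀ (by positivity) (by positivity)]; nlinarith
  have i2 : (2 * (m : ℝ) + 1) / (2 * m + 3) ≤ (2 * n + 1) / (2 * n + 3) := by
    rw [div_le_div_iff₀ (by positivity) (by positivity)]; nlinarith
  exact mul_le_mul i1 i2 (by positivity) (by positivity)

/-- Kaluza's criterion for the series of `arcsin z / z`. -/
lemma coeff_one_sub_inv_arcsinSeries_nonneg (n : ℕ) :
    0 ≤ coeff n (1 - arcsinSeries⁻¹) := by
  set P := 1 - arcsinSeries⁻¹ with hP
  have hinv : arcsinSeries * arcsinSeries⁻¹ = 1 :=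
    PowerSeries.mul_inv_cancel _ (by simp [constantCoeff_arcsinSeries])
  -- The renewal equation for `P` = 1 - 1/A. It expresses each coefficient of `P` through earlier
  -- ones.
  have hA : arcsinSeries = 1 + P * arcsinSeries := by
    rw [hP]; linear_combination hinv
  have hP0 : coeff 0 P = 0 := by
    simp [hP, constantCoeff_arcsinSeries]
  induction n using Nat.strong_induction_on with
  | _ n ih =>
    match n with
    | 0 => rw [hP0]
    | 1 =>
      have h1 := congrArg (coeff 1) hA
      rw [map_add, coeff_mul, Finset.Nat.sum_antidiagonal_eq_sum_range_succ_mk,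
        Finset.sum_range_succ, Finset.sum_range_succ, Finset.sum_range_zero, hP0, coeff_one] at h1
      have h2 : coeff (1 - 1) arcsinSeries = 1 := by
        simp [constantCoeff_arcsinSeries]
      have := coeff_arcsinSeries_pos 1
      simp only [h2] at h1
      simp at h1
      linarith
    | n + 2 =>
      have h1 := congrArg (coeff (n + 1)) hA
      have h2 := congrArg (coeff (n + 2)) hA
      rw [map_add, coeff_mul, Finset.Nat.sum_antidiagonal_eq_sum_range_succ_mk, coeff_one] at h1 h2
      rw [Finset.sum_range_succ] at h2
      simp only [Nat.add_eq_zero_iff, one_ne_zero, and_false, if_false, zero_add,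
        OfNat.ofNat_ne_zero, tsub_self] at h1 h2
      set r : ℝ := (2 * ((n + 1 : ℕ) : ℝ) + 1) ^ 2 /
        ((2 * ((n + 1 : ℕ) : ℝ) + 2) * (2 * ((n + 1 : ℕ) : ℝ) + 3)) with hr
      -- Every ratio in the sum is at most the last ratio `r`. The sum is therefore at most r times
      -- the coefficient of degree n + 1, which is the coefficient of degree n + 2; what remains is
      -- the next coefficient of `P`.
      have h3 : ∑ k ∈ Finset.range (n + 2), coeff k P * coeff (n + 2 - k) arcsinSeries ≤
          ∑ k ∈ Finset.range (n + 2), r * (coeff k P * coeff (n + 1 - k) arcsinSeries) := by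
        refine Finset.sum_le_sum fun k hk => ?_
        have hk' := Finset.mem_range.1 hk
        have hp := ih k hk'
        rw [show n + 2 - k = (n + 1 - k) + 1 by omega, coeff_arcsinSeries_succ]
        have hm := arcsin_ratio_mono (show n + 1 - k ≤ n + 1 by omega)
        have ha := (coeff_arcsinSeries_pos (n + 1 - k)).le
        calc coeff k P * (coeff (n + 1 - k) arcsinSeries * _)
            ≤ coeff k P * (coeff (n + 1 - k) arcsinSeries * r) := by gcongr
          _ = _ := by ring
      rw [← Finset.mul_sum, ← h1] at h3
      have h4 := coeff_arcsinSeries_succ (n + 1)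
      rw [← hr] at h4
      have h5 : coeff 0 arcsinSeries = 1 := by
        simp [constantCoeff_arcsinSeries]
      rw [show n + 1 + 1 = n + 2 by ring] at h4
      simp only [h5] at h2
      nlinarith

lemma coeff_mul_nonneg {f g : ℝ⟦X⟧} (hf : ∀ n, 0 ≤ coeff n f) (hg : ∀ n, 0 ≤ coeff n g) (n : ℕ) :
    0 ≤ coeff n (f * g) := by
  rw [coeff_mul]; exact Finset.sum_nonneg fun p _ => mul_nonneg (hf _) (hg _)

lemma coeff_arcsinLogDeriv_nonneg (n : ℕ) : 0 ≤ coeff n arcsinLogDeriv := by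
  have hinv : arcsinSeries * arcsinSeries⁻¹ = 1 :=
    PowerSeries.mul_inv_cancel _ (by simp [constantCoeff_arcsinSeries])
  -- A'/A = (1 - 1/A)' A is a product of two series with nonnegative coefficients.
  have h : arcsinLogDeriv = d⁄dX ℝ (1 - arcsinSeries⁻¹) * arcsinSeries := by
    rw [arcsinLogDeriv, map_sub, derivative_one, derivative_inv']
    linear_combination -arcsinSeries⁻¹ * d⁄dX ℝ arcsinSeries * hinv
  rw [h]
  refine coeff_mul_nonneg (fun n => ?_) (fun n => (coeff_arcsinSeries_pos n).le) n
  rw [coeff_derivative]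
  have := coeff_one_sub_inv_arcsinSeries_nonneg (n + 1)
  positivity

lemma arcsinPowCoeff_nonneg {α : ℝ} (hα : 0 ≤ α) (n : ℕ) : 0 ≤ arcsinPowCoeff α n := by
  induction n using Nat.strong_induction_on with
  | _ n ih =>
    cases n with
    | zero => simp [arcsinPowCoeff]
    | succ n =>
      rw [arcsinPowCoeff_succ]
      refine mul_nonneg (by positivity) (Finset.sum_nonneg fun k hk => ?_)
      exact mul_nonneg (coeff_arcsinLogDeriv_nonneg _) (ih k (Finset.mem_range.1 hk))

/-- The recursion has nonnegative weights and the prefactor α, so monotonicity propagates by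
induction. This reduces all exponents in [0, 2] to the exponent 2, an honest square. -/
lemma arcsinPowCoeff_mono {α β : ℝ} (hα : 0 ≤ α) (h : α ≤ β) (n : ℕ) :
    arcsinPowCoeff α n ≤ arcsinPowCoeff β n := by
  induction n using Nat.strong_induction_on with
  | _ n ih =>
    cases n with
    | zero => simp [arcsinPowCoeff]
    | succ n =>
      rw [arcsinPowCoeff_succ, arcsinPowCoeff_succ]
      refine mul_le_mul (by gcongr) (Finset.sum_le_sum fun k hk => ?_) ?_ ?_
      · exact mul_le_mul_of_nonneg_left (ih k (Finset.mem_range.1 hk))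
          (coeff_arcsinLogDeriv_nonneg _)
      · exact Finset.sum_nonneg fun k _ =>
          mul_nonneg (coeff_arcsinLogDeriv_nonneg _) (arcsinPowCoeff_nonneg hα k)
      · have := hα.trans h
        positivity

lemma coeff_succ_arcsinSeries_le (n : ℕ) : coeff (n + 1) arcsinSeries ≤ 1 / 6 := by
  induction n with
  | zero => rw [coeff_arcsinSeries]; norm_num [invSqrtCoeff]
  | succ n ih =>
    rw [coeff_arcsinSeries_succ]
    have h := (coeff_arcsinSeries_pos (n + 1)).le
    refine le_trans (mul_le_of_le_one_right h ?_) ih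
    rw [div_le_one (by positivity)]
    nlinarith [(Nat.cast_nonneg (n + 1) : (0 : ℝ) ≤ ((n + 1 : ℕ) : ℝ))]

lemma sum_coeff_arcsinSeries_le (n : ℕ) :
    ∑ k ∈ Finset.range n, coeff (k + 1) arcsinSeries ≤ 1 - 2 * invSqrtCoeff (n + 1) := by
  induction n with
  | zero => norm_num [invSqrtCoeff]
  | succ n ih =>
    rw [Finset.sum_range_succ]
    -- Telescoping: the right side equals `invSqrtCoeff (n + 1)` divided by n + 2, the left side is
    -- the same number divided by 2n + 3.
    have h : coeff (n + 1) arcsinSeries ≤ 2 * (invSqrtCoeff (n + 1) - invSqrtCoeff (n + 1 + 1)) := by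
      rw [coeff_arcsinSeries, invSqrtCoeff.eq_2 (n + 1)]
      have hp := invSqrtCoeff_pos (n + 1)
      have : 2 * (invSqrtCoeff (n + 1) - invSqrtCoeff (n + 1) *
          ((2 * ((n + 1 : ℕ) : ℝ) + 1) / (2 * ((n + 1 : ℕ) : ℝ) + 2))) =
          invSqrtCoeff (n + 1) / (((n + 1 : ℕ) : ℝ) + 1) := by
        field_simp; ring
      rw [this]
      have : (0 : ℝ) ≤ ((n + 1 : ℕ) : ℝ) := by positivity
      gcongr
      linarith
    linarith

/-- In the convolution square the two end terms are at most 1/6 each. Each middle term has a factor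
at most 1/6, and the other factors sum to less than 1. The total stays below 1/2. -/
lemma arcsinPowCoeff_two_lt_one (n : ℕ) : arcsinPowCoeff 2 (n + 1) < 1 := by
  have h : arcsinPowCoeff 2 (n + 1) = coeff (n + 1) (arcsinSeries ^ 2) := by
    rw [← arcsinPowSeries_two]; simp [arcsinPowSeries]
  have h0 : coeff 0 arcsinSeries = 1 := by simp [constantCoeff_arcsinSeries]
  rw [h, pow_two, coeff_mul, Finset.Nat.sum_antidiagonal_eq_sum_range_succ_mk,
    Finset.sum_range_succ, Finset.sum_range_succ']
  simp only [Nat.sub_zero, Nat.sub_self, h0, one_mul, mul_one]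
  have hs : ∑ k ∈ Finset.range n, coeff (k + 1) arcsinSeries * coeff (n + 1 - (k + 1)) arcsinSeries
      ≤ ∑ k ∈ Finset.range n, coeff (k + 1) arcsinSeries * (1 / 6) := by
    refine Finset.sum_le_sum fun k hk => ?_
    have hk' := Finset.mem_range.1 hk
    have := coeff_succ_arcsinSeries_le (n - 1 - k)
    rw [show n - 1 - k + 1 = n + 1 - (k + 1) by omega] at this
    exact mul_le_mul_of_nonneg_left this (coeff_arcsinSeries_pos _).le
  rw [← Finset.sum_mul] at hs
  have h1 := sum_coeff_arcsinSeries_le n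
  have h2 := coeff_succ_arcsinSeries_le n
  have h3 := invSqrtCoeff_pos (n + 1)
  linarith

lemma arcsinPowCoeff_lt_one {α : ℝ} (hα : 0 ≤ α) (h2 : α ≤ 2) {n : ℕ} (hn : n ≠ 0) :
    arcsinPowCoeff α n < 1 := by
  obtain ⟨m, rfl⟩ := Nat.exists_eq_succ_of_ne_zero hn
  exact (arcsinPowCoeff_mono hα h2 _).trans_lt (arcsinPowCoeff_two_lt_one m)

end RieszCompact

/-! ### Even expansions near 0: the passage between functions of θ and power series in θ². -/

namespace RieszCompact

open PowerSeries Filter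

/-- The function `f` is, near `0`, the sum of the power series `F` evaluated at `θ^2`. -/
def HasEvenExpansion (F : ℝ⟦X⟧) (f : ℝ → ℝ) : Prop :=
  ∀ᶠ θ : ℝ in 𝓝[≠] 0, HasSum (fun p : ℕ => coeff p F * |θ| ^ (2 * p)) (f θ)

namespace HasEvenExpansion

variable {F G : ℝ⟦X⟧} {f g : ℝ → ℝ}

lemma congr (hF : HasEvenExpansion F f) (h : ∀ θ, θ ≠ 0 → f θ = g θ) : HasEvenExpansion F g := by
  filter_upwards [hF, self_mem_nhdsWithin] with θ hθ h0
  rwa [← h θ h0]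

lemma of_poly {n : ℕ} {F : ℝ⟦X⟧} (hF : ∀ m, n ≤ m → coeff m F = 0) :
    HasEvenExpansion F fun θ => ∑ m ∈ Finset.range n, coeff m F * |θ| ^ (2 * m) := by
  refine Eventually.of_forall fun θ => hasSum_sum_of_ne_finset_zero fun m hm => ?_
  rw [hF m (by simpa using hm), zero_mul]

lemma const (r : ℝ) : HasEvenExpansion (C r) fun _ => r := by
  have := of_poly (n := 1) (F := C r) fun m hm => by
    rw [coeff_C, if_neg (by omega)]
  simpa using this

lemma add (hF : HasEvenExpansion F f) (hG : HasEvenExpansion G g) :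
    HasEvenExpansion (F + G) fun θ => f θ + g θ := by
  filter_upwards [hF, hG] with θ h1 h2
  simpa only [map_add, add_mul] using h1.add h2

lemma neg (hF : HasEvenExpansion F f) : HasEvenExpansion (-F) fun θ => -f θ := by
  filter_upwards [hF] with θ h1
  simpa only [map_neg, neg_mul] using h1.neg

lemma sub (hF : HasEvenExpansion F f) (hG : HasEvenExpansion G g) :
    HasEvenExpansion (F - G) fun θ => f θ - g θ := by
  simpa only [sub_eq_add_neg] using hF.add hG.neg

lemma mul (hF : HasEvenExpansion F f) (hG : HasEvenExpansion G g) :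
    HasEvenExpansion (F * G) fun θ => f θ * g θ := by
  filter_upwards [hF, hG] with θ h1 h2
  have e : (fun p => coeff p (F * G) * |θ| ^ (2 * p)) = fun p =>
      ∑ kl ∈ Finset.HasAntidiagonal.antidiagonal p,
        coeff kl.1 F * |θ| ^ (2 * kl.1) * (coeff kl.2 G * |θ| ^ (2 * kl.2)) := by
    ext p
    rw [coeff_mul, Finset.sum_mul]
    refine Finset.sum_congr rfl fun kl hkl => ?_
    rw [← Finset.HasAntidiagonal.mem_antidiagonal.1 hkl]
    ring
  have s := summable_norm_sum_mul_antidiagonal_of_summable_norm h1.summable.norm h2.summable.norm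
  have t := tsum_mul_tsum_eq_tsum_sum_antidiagonal_of_summable_norm h1.summable.norm
    h2.summable.norm
  rw [e, ← h1.tsum_eq, ← h2.tsum_eq, t]
  exact s.of_norm.hasSum

lemma pow (hF : HasEvenExpansion F f) (n : ℕ) : HasEvenExpansion (F ^ n) fun θ => f θ ^ n := by
  induction n with
  | zero => simpa using const 1
  | succ n ih => simpa only [pow_succ] using ih.mul hF

lemma sum {ι : Type*} (s : Finset ι) {F : ι → ℝ⟦X⟧} {f : ι → ℝ → ℝ}
    (h : ∀ i ∈ s, HasEvenExpansion (F i) (f i)) :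
    HasEvenExpansion (∑ i ∈ s, F i) fun θ => ∑ i ∈ s, f i θ := by
  classical
  induction s using Finset.induction_on with
  | empty => simpa using const 0
  | insert i s hi ih =>
    simp only [Finset.sum_insert hi]
    exact (h i (Finset.mem_insert_self i s)).add
      (ih fun j hj => h j (Finset.mem_insert_of_mem hj))

lemma const_mul (r : ℝ) (hF : HasEvenExpansion F f) :
    HasEvenExpansion (C r * F) fun θ => r * f θ := (const r).mul hF

/-- Cauchy's estimate: convergence at one point r ≠ 0 bounds the coefficients by M |r|^(-2p). For
|θ| < |r|/2 the tail from degree n on is then dominated by a geometric series of ratio 1/2, whence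
the factor 2 in the constant. -/
lemma bound (hF : HasEvenExpansion F f) {n : ℕ} (h0 : ∀ m < n, coeff m F = 0) :
    ∃ K, 0 ≤ K ∧ ∀ᶠ θ : ℝ in 𝓝[≠] 0, |f θ| ≤ K * |θ| ^ (2 * n) := by
  obtain ⟨r, hr, hr0⟩ := (hF.and self_mem_nhdsWithin).exists
  have hr0' : 0 < |r| := abs_pos.2 hr0
  obtain ⟨M, hM⟩ : ∃ M, ∀ p, |coeff p F * |r| ^ (2 * p)| ≤ M := by
    obtain ⟨M, hM⟩ := (Metric.isBounded_range_of_tendsto _ hr.summable.tendsto_atTop_zero).exists_norm_le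
    exact ⟨M, fun p => hM _ ⟨p, rfl⟩⟩
  have hM0 : 0 ≤ M := (abs_nonneg _).trans (hM 0)
  refine ⟨2 * M / |r| ^ (2 * n), by positivity, ?_⟩
  have hsmall : ∀ᶠ θ : ℝ in 𝓝[≠] 0, |θ| < |r| / 2 := by
    refine nhdsWithin_le_nhds ?_
    have : Tendsto (fun θ : ℝ => |θ|) (𝓝 0) (𝓝 |0|) := continuous_abs.tendsto 0
    rw [abs_zero] at this
    exact this.eventually (gt_mem_nhds (by positivity))
  filter_upwards [hF, hsmall] with θ hθ hlt
  have hq : |θ| / |r| ≤ 1 / 2 := by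
    rw [div_le_iff₀ hr0']; linarith
  have hq0 : 0 ≤ |θ| / |r| := by positivity
  set q := (|θ| / |r|) ^ 2 with hqdef
  have hq1 : q ≤ 1 / 2 := by rw [hqdef]; nlinarith
  have hqn : 0 ≤ q := by positivity
  have hterm : ∀ p, |coeff p F * |θ| ^ (2 * p)| ≤ M * q ^ n * (1 / 2) ^ (p - n : ℕ) := by
    intro p
    rcases lt_or_ge p n with hp | hp
    · rw [h0 p hp]; simp only [zero_mul, abs_zero]; positivity
    · have e : coeff p F * |θ| ^ (2 * p) = coeff p F * |r| ^ (2 * p) * (q ^ n * q ^ (p - n)) := by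
        rw [← pow_add, Nat.add_sub_cancel' hp, hqdef, ← pow_mul, div_pow]
        field_simp
      rw [e, abs_mul, abs_of_nonneg (by positivity : 0 ≤ q ^ n * q ^ (p - n)), ← mul_assoc]
      gcongr
      exact hM p
  have hs : HasSum (fun k : ℕ => coeff (k + n) F * |θ| ^ (2 * (k + n))) (f θ) := by
    have := (hasSum_nat_add_iff' (f := fun p : ℕ => coeff p F * |θ| ^ (2 * p)) n).2 hθ
    rwa [Finset.sum_eq_zero fun p hp => by rw [h0 p (Finset.mem_range.1 hp), zero_mul],
      sub_zero] at this
  have hg : HasSum (fun k : ℕ => M * q ^ n * (1 / 2 : ℝ) ^ k) (M * q ^ n * 2) :=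
    hasSum_geometric_two.mul_left _
  have := tsum_of_norm_bounded (f := fun k : ℕ => coeff (k + n) F * |θ| ^ (2 * (k + n))) hg
    fun k => by
      have := hterm (k + n)
      rwa [Nat.add_sub_cancel] at this
  rw [hs.tsum_eq, Real.norm_eq_abs] at this
  refine this.trans (le_of_eq ?_)
  rw [hqdef, ← pow_mul, div_pow]
  field_simp

lemma coeff_eq_zero_of_zero (hF : HasEvenExpansion F fun _ => 0) : F = 0 := by
  ext n
  rw [map_zero]
  induction n using Nat.strong_induction_on with
  | _ n ih =>
    -- Without its n-th term the series starts at degree n + 1, so that term itself is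
    -- O(|θ|^(2n+2)). Dividing by |θ|^(2n) and letting θ tend to 0 kills the coefficient.
    have hd : HasEvenExpansion (F - C (coeff n F) * X ^ n)
        fun θ => -(coeff n F * |θ| ^ (2 * n)) := by
      have h1 : HasEvenExpansion (C (coeff n F) * X ^ n) fun θ => coeff n F * |θ| ^ (2 * n) := by
        refine Eventually.of_forall fun θ => ?_
        convert hasSum_single (α := ℝ) (f := fun p => coeff p (C (coeff n F) * X ^ n) *
          |θ| ^ (2 * p)) n fun m hm => ?_ using 1
        · simp [coeff_C_mul]
        · rw [coeff_C_mul, coeff_X_pow, if_neg hm]; simp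
      simpa using hF.sub h1
    obtain ⟨K, hK0, hK⟩ := hd.bound (n := n + 1) fun m hm => by
      rw [map_sub, coeff_C_mul, coeff_X_pow]
      rcases Nat.lt_succ_iff_lt_or_eq.1 hm with h | rfl
      · rw [ih m h, if_neg h.ne]; simp
      · simp
    have hb : ∀ᶠ θ : ℝ in 𝓝[≠] 0, |coeff n F| ≤ K * |θ| ^ 2 := by
      filter_upwards [hK, self_mem_nhdsWithin] with θ h h0
      have h0' : 0 < |θ| := abs_pos.2 h0
      rw [abs_neg, abs_mul, abs_of_nonneg (by positivity : 0 ≤ |θ| ^ (2 * n)), mul_add, pow_add,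
        mul_comm (|θ| ^ (2 * n)), ← mul_assoc] at h
      exact le_of_mul_le_mul_right h (by positivity)
    have hlim : Tendsto (fun θ : ℝ => K * |θ| ^ 2) (𝓝[≠] 0) (𝓝 0) := by
      have : Continuous fun θ : ℝ => K * |θ| ^ 2 := by fun_prop
      simpa using (this.tendsto 0).mono_left nhdsWithin_le_nhds
    have := ge_of_tendsto hlim hb
    exact abs_nonpos_iff.1 this

lemma unique (hF : HasEvenExpansion F f) (hG : HasEvenExpansion G f) : F = G :=
  sub_eq_zero.1 (coeff_eq_zero_of_zero (by simpa using hF.sub hG))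

end HasEvenExpansion

/-! ### The expansion of |2 sin(θ/2)/θ|^α and the coefficients a_p. -/

lemma isSincExpansion_iff {α : ℝ} {a : ℕ → ℝ} :
    IsSincExpansion α a ↔
      HasEvenExpansion (mk a) fun θ => |2 * Real.sin (θ / 2) / θ| ^ α := by
  simp [IsSincExpansion, HasEvenExpansion]

lemma hasSum_sincSeries {θ : ℝ} (hθ : θ ≠ 0) :
    HasSum (fun p : ℕ => coeff p sincSeries * (θ ^ 2) ^ p) (2 * Real.sin (θ / 2) / θ) := by
  have h := ((Real.hasSum_sin (θ / 2)).mul_left 2).div_const θ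
  convert! h using 2 with p
  rw [sincSeries, coeff_mk, div_pow, pow_succ θ (2 * p), pow_succ (2 : ℝ), pow_mul θ,
    pow_mul (2 : ℝ)]
  norm_num
  field_simp

lemma hasEvenExpansion_sincSeries :
    HasEvenExpansion sincSeries fun θ => 2 * Real.sin (θ / 2) / θ := by
  filter_upwards [self_mem_nhdsWithin] with θ hθ
  simpa only [pow_mul, sq_abs] using hasSum_sincSeries hθ

lemma hasEvenExpansion_cosSeries (r : ℝ) :
    HasEvenExpansion (cosSeries r) fun θ => Real.cos (r * θ) := by
  refine Eventually.of_forall fun θ => ?_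
  have h := Real.hasSum_cos (r * θ)
  convert! h using 2 with p
  rw [cosSeries, coeff_mk, mul_pow, pow_mul |θ|, sq_abs, ← pow_mul]
  ring

lemma hasEvenExpansion_X : HasEvenExpansion X fun θ => θ ^ 2 := by
  have := HasEvenExpansion.of_poly (n := 2) (F := X) fun m hm => by
    rw [coeff_X, if_neg (by omega)]
  simpa [Finset.sum_range_succ, coeff_X] using this

/-- The Taylor series at `0`. -/
def taylorSeries (f : ℝ → ℝ) : ℝ⟦X⟧ := mk fun n => iteratedDeriv n f 0 / n.factorial

lemma taylorSeries_congr {f g : ℝ → ℝ} (h : f =ᶠ[𝓝 0] g) : taylorSeries f = taylorSeries g := by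
  ext n; simp [taylorSeries, h.iteratedDeriv_eq n]

lemma taylorSeries_deriv (f : ℝ → ℝ) : taylorSeries (deriv f) = d⁄dX ℝ (taylorSeries f) := by
  ext n
  rw [coeff_derivative]
  simp only [taylorSeries, coeff_mk, ← iteratedDeriv_succ', Nat.factorial_succ]
  push_cast
  field_simp

lemma taylorSeries_mul {f g : ℝ → ℝ} (hf : AnalyticAt ℝ f 0) (hg : AnalyticAt ℝ g 0) :
    taylorSeries (f * g) = taylorSeries f * taylorSeries g := by
  ext n
  simp only [taylorSeries, coeff_mk, coeff_mul]
  rw [iteratedDeriv_mul hf.contDiffAt hg.contDiffAt, Finset.sum_div,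
    Finset.Nat.sum_antidiagonal_eq_sum_range_succ_mk]
  refine Finset.sum_congr rfl fun i hi => ?_
  rw [Nat.cast_choose _ (by grind)]
  field_simp [Nat.factorial_ne_zero]

lemma taylorSeries_const (r : ℝ) : taylorSeries (fun _ => r) = C r := by
  ext n
  rw [taylorSeries, coeff_mk, iteratedDeriv_const, coeff_C]
  split_ifs with h
  · simp [h]
  · simp

lemma hasSum_taylorSeries {f : ℝ → ℝ} (hf : AnalyticAt ℝ f 0) :
    ∀ᶠ x in 𝓝 0, HasSum (fun n => coeff n (taylorSeries f) * x ^ n) (f x) := by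
  filter_upwards [hf.hasFPowerSeriesAt.eventually_hasSum] with x hx
  simpa [taylorSeries, mul_comm] using hx

/-- The entire function with `sincFun (θ ^ 2) = 2 * sin (θ / 2) / θ`. -/
def sincFun (x : ℝ) : ℝ := ∑' p : ℕ, coeff p sincSeries * x ^ p

lemma sincFun_hasFPowerSeriesAt : HasFPowerSeriesAt sincFun
    (FormalMultilinearSeries.ofScalars ℝ fun p => coeff p sincSeries) 0 := by
  have hr : (0 : ENNReal) <
      (FormalMultilinearSeries.ofScalars ℝ fun p => coeff p sincSeries).radius := by
    refine lt_of_lt_of_le ?_ (FormalMultilinearSeries.le_radius_of_bound (r := 1) _ 1 fun n => ?_)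
    · simp
    · rw [FormalMultilinearSeries.ofScalars_norm, sincSeries, coeff_mk, Real.norm_eq_abs, abs_div,
        abs_pow, abs_neg, abs_one, one_pow, NNReal.coe_one, one_pow, mul_one, abs_of_pos (by positivity)]
      rw [div_le_one (by positivity)]
      have h1 : (1 : ℝ) ≤ 4 ^ n := one_le_pow₀ (by norm_num)
      have h2 : (1 : ℝ) ≤ (2 * n + 1).factorial := by exact_mod_cast Nat.factorial_pos _
      nlinarith
  have h := (FormalMultilinearSeries.ofScalars ℝ fun p =>
    coeff p sincSeries).hasFPowerSeriesOnBall hr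
  have e : (FormalMultilinearSeries.ofScalars ℝ fun p => coeff p sincSeries).sum = sincFun := by
    ext x
    simp [FormalMultilinearSeries.sum, sincFun, mul_comm]
  rw [e] at h
  exact h.hasFPowerSeriesAt

lemma sincFun_analyticAt : AnalyticAt ℝ sincFun 0 := ⟨_, sincFun_hasFPowerSeriesAt⟩

lemma sincFun_zero : sincFun 0 = 1 := by
  rw [sincFun, tsum_eq_single 0 fun p hp => by simp [hp]]
  simp [constantCoeff_sincSeries]

lemma sincFun_sq {θ : ℝ} (hθ : θ ≠ 0) : sincFun (θ ^ 2) = 2 * Real.sin (θ / 2) / θ :=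
  (hasSum_sincSeries hθ).tsum_eq

lemma taylorSeries_sincFun : taylorSeries sincFun = sincSeries := by
  have h := HasFPowerSeriesAt.eq_formalMultilinearSeries sincFun_analyticAt.hasFPowerSeriesAt
    sincFun_hasFPowerSeriesAt
  ext n
  have := congrArg (fun p : FormalMultilinearSeries ℝ ℝ ℝ => p.coeff n) h
  simpa [taylorSeries] using this

/-- The expansion of `|2 sin (θ / 2) / θ| ^ α`, with the differential equation it satisfies. -/
lemma exists_sincPow_expansion (α : ℝ) : ∃ A : ℝ⟦X⟧,
    HasEvenExpansion A (fun θ => |2 * Real.sin (θ / 2) / θ| ^ α) ∧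
    constantCoeff A = 1 ∧ sincSeries * d⁄dX ℝ A = C α * (d⁄dX ℝ sincSeries * A) := by
  -- The power is taken as a function of x = θ². It is analytic at 0 because `sincFun 0 = 1`, where
  -- the binomial series applies, and its Taylor series is the expansion sought.
  set H : ℝ → ℝ := fun x => sincFun x ^ α with hH
  have hG := sincFun_analyticAt
  have hHa : AnalyticAt ℝ H 0 := by
    have h1 : AnalyticAt ℝ (fun x : ℝ => (1 + x) ^ α) (sincFun 0 - 1) := by
      rw [sincFun_zero, sub_self]
      exact ⟨_, Real.one_add_rpow_hasFPowerSeriesAt_zero⟩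
    have h2 := h1.comp (f := fun x => sincFun x - 1) (hG.sub analyticAt_const)
    refine h2.congr (Eventually.of_forall fun x => ?_)
    simp [hH]
  have hpos : ∀ᶠ x in 𝓝 (0 : ℝ), 0 < sincFun x :=
    hG.continuousAt.eventually (lt_mem_nhds (by rw [sincFun_zero]; norm_num))
  have hsq : Tendsto (fun θ : ℝ => θ ^ 2) (𝓝[≠] 0) (𝓝 0) := by
    have : Continuous fun θ : ℝ => θ ^ 2 := by fun_prop
    simpa using (this.tendsto 0).mono_left nhdsWithin_le_nhds
  refine ⟨taylorSeries H, ?_, ?_, ?_⟩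
  · filter_upwards [hsq.eventually (hasSum_taylorSeries hHa), hsq.eventually hpos,
      self_mem_nhdsWithin] with θ h1 h2 h3
    rw [sincFun_sq h3] at h2
    simpa only [pow_mul, sq_abs, abs_of_pos h2, hH, sincFun_sq h3] using h1
  · rw [← coeff_zero_eq_constantCoeff_apply]
    simp [taylorSeries, hH, sincFun_zero]
  · rw [← taylorSeries_deriv, ← taylorSeries_sincFun, ← taylorSeries_deriv, ← taylorSeries_const,
      ← taylorSeries_mul hG hHa.deriv, ← taylorSeries_mul hG.deriv hHa,
      ← taylorSeries_mul analyticAt_const (hG.deriv.mul hHa)]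
    refine taylorSeries_congr ?_
    -- The differential equation is the chain rule H' = α G' G^(α-1) multiplied by G = `sincFun`,
    -- valid where G > 0.
    filter_upwards [hpos, hG.eventually_analyticAt] with x hx hxa
    have hd : HasDerivAt H (deriv sincFun x * α * sincFun x ^ (α - 1)) x :=
      hxa.differentiableAt.hasDerivAt.rpow_const (Or.inl hx.ne')
    simp only [Pi.mul_apply]
    rw [hd.deriv, hH, Real.rpow_sub_one hx.ne']
    field_simp

lemma existsUnique_isSincExpansion (α : ℝ) : ∃! a : ℕ → ℝ, IsSincExpansion α a := by
  obtain ⟨A, hA, -, -⟩ := exists_sincPow_expansion α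
  refine ⟨fun p => coeff p A, isSincExpansion_iff.2 ?_, fun a ha => ?_⟩
  · convert hA using 1
    ext p; simp
  · have := (isSincExpansion_iff.1 ha).unique hA
    ext p
    rw [← this, coeff_mk]

lemma IsSincExpansion.spec {α : ℝ} {a : ℕ → ℝ} (ha : IsSincExpansion α a) :
    constantCoeff (mk a) = 1 ∧
      sincSeries * d⁄dX ℝ (mk a) = C α * (d⁄dX ℝ sincSeries * mk a) := by
  obtain ⟨A, hA, h⟩ := exists_sincPow_expansion α
  rwa [(isSincExpansion_iff.1 ha).unique hA]

lemma IsSincExpansion.values {α : ℝ} {a : ℕ → ℝ} (ha : IsSincExpansion α a) :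
    a 0 = 1 ∧ a 1 = -α / 24 ∧ a 2 = (1 / 1920 + (α - 1) / 1152) * α ∧
      a 3 = -(1 / 322560 + (α - 1) / 46080 + (α - 1) * (α - 2) / 82944) * α := by
  obtain ⟨h0, h⟩ := ha.spec
  rw [← coeff_zero_eq_constantCoeff_apply, coeff_mk] at h0
  -- Coefficient n of the differential equation determines a_{n+1} from the earlier values; n = 0,
  -- 1, 2 suffice.
  have e : ∀ n, ∑ k ∈ Finset.range (n + 1), coeff k sincSeries * (a (n - k + 1) * ((n - k : ℕ) + 1)) =
      α * ∑ k ∈ Finset.range (n + 1), (coeff (k + 1) sincSeries * (k + 1)) * a (n - k) := by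
    intro n
    have := congrArg (coeff n) h
    rw [coeff_mul, coeff_C_mul, coeff_mul, Finset.Nat.sum_antidiagonal_eq_sum_range_succ_mk,
      Finset.Nat.sum_antidiagonal_eq_sum_range_succ_mk] at this
    simpa only [coeff_derivative, coeff_mk] using this
  have e0 := e 0
  have e1 := e 1
  have e2 := e 2
  simp only [Finset.sum_range_succ, Finset.sum_range_zero, sincSeries, coeff_mk,
    Nat.factorial_succ, Nat.factorial_zero] at e0 e1 e2
  norm_num at e0 e1 e2
  rw [h0] at e0 e1 e2
  have a1 : a 1 = -α / 24 := by linarith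
  rw [a1] at e1 e2
  have a2 : a 2 = (1 / 1920 + (α - 1) / 1152) * α := by linear_combination e1 / 2
  rw [a2] at e2
  refine ⟨h0, a1, a2, ?_⟩
  linear_combination e2 / 3

end RieszCompact

/-! ### The coefficients b_ℓ and the matching equation. -/

namespace RieszCompact

open PowerSeries Filter

/-- The coefficients `b_ℓ`. -/
def compactCoeff (α : ℝ) (l : ℕ) : ℝ := (-1 / 4) ^ l * arcsinPowCoeff α l

/-- The power series in `x = θ^2` of the symbol `2 cos θ - 2` of `δ_x^2`. -/
def diffSymbolSeries : ℝ⟦X⟧ := -(X * sincSeries ^ 2)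

lemma sinSqSeries_eq : sinSqSeries = C (-1 / 4) * diffSymbolSeries := by
  have h : C (R := ℝ) (-1 / 4) * 4 = -1 := by
    rw [← map_ofNat (C (R := ℝ)) 4, ← map_mul]; norm_num
  rw [diffSymbolSeries]
  linear_combination sinSqSeries * h - C (-1 / 4) * four_mul_sinSqSeries

/-- Truncating (arcsin z / z)^α before z^(2n) leaves a multiple of w^n. After substituting w =
sin²(θ/2), which has no constant term in X = θ², this becomes a multiple of X^n, while the full
series times `A` is 1. -/
lemma sum_compactCoeff_dvd {α : ℝ} {A : ℝ⟦X⟧}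
    (hA : sincSeries * d⁄dX ℝ A = C α * (d⁄dX ℝ sincSeries * A))
    (hA0 : constantCoeff A = 1) (n : ℕ) :
    X ^ n ∣ (∑ l ∈ Finset.range n, C (compactCoeff α l) * diffSymbolSeries ^ l) * A - 1 := by
  have hC : ∀ r, substSinSq (C r) = C r := fun r => by
    have := substSinSq.commutes r
    simpa [PowerSeries.algebraMap_apply] using this
  obtain ⟨G, hG⟩ : X ^ n ∣ arcsinPowSeries α -
      ∑ l ∈ Finset.range n, C (arcsinPowCoeff α l) * X ^ l := by
    refine X_pow_dvd_iff.2 fun m hm => ?_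
    rw [map_sub, map_sum, Finset.sum_eq_single m]
    · simp [arcsinPowSeries]
    · intro l _ hl
      rw [coeff_C_mul, coeff_X_pow, if_neg hl.symm, mul_zero]
    · intro h; exact absurd (Finset.mem_range.2 hm) h
  have h1 := congrArg substSinSq hG
  rw [map_sub, map_sum, map_mul, map_pow, substSinSq_X] at h1
  simp only [map_mul, map_pow, hC, substSinSq_X] at h1
  have h2 : ∑ l ∈ Finset.range n, C (compactCoeff α l) * diffSymbolSeries ^ l =
      ∑ l ∈ Finset.range n, C (arcsinPowCoeff α l) * sinSqSeries ^ l := by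
    refine Finset.sum_congr rfl fun l _ => ?_
    rw [sinSqSeries_eq, mul_pow, compactCoeff, map_mul, map_pow]
    ring
  have h3 := substSinSq_arcsinPowSeries_mul hA hA0
  have hX : X ^ n ∣ sinSqSeries ^ n :=
    pow_dvd_pow_of_dvd (X_dvd_iff.2 constantCoeff_sinSqSeries) n
  rw [h2]
  have e : (∑ l ∈ Finset.range n, C (arcsinPowCoeff α l) * sinSqSeries ^ l) * A - 1 =
      sinSqSeries ^ n * (-(substSinSq G * A)) := by
    linear_combination h3 - A * h1
  rw [e]
  exact hX.mul_right _

lemma coeff_diffSymbolSeries_pow_mul (l : ℕ) (A : ℝ⟦X⟧) :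
    coeff l (diffSymbolSeries ^ l * A) = (-1) ^ l * constantCoeff A := by
  have : diffSymbolSeries ^ l * A = X ^ l * ((C (-1) * sincSeries ^ 2) ^ l * A) := by
    rw [diffSymbolSeries, map_neg, map_one]
    ring
  rw [this]
  have h := coeff_X_pow_mul ((C (-1) * sincSeries ^ 2) ^ l * A) l 0
  rw [zero_add] at h
  rw [h, coeff_zero_eq_constantCoeff_apply]
  simp [constantCoeff_sincSeries]

lemma coeff_diffSymbolSeries_pow_mul_of_lt {l m : ℕ} (h : m < l) (A : ℝ⟦X⟧) :
    coeff m (diffSymbolSeries ^ l * A) = 0 := by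
  have : X ^ l ∣ diffSymbolSeries ^ l * A := by
    refine Dvd.dvd.mul_right (pow_dvd_pow_of_dvd ?_ l) A
    rw [diffSymbolSeries]
    exact (Dvd.intro _ rfl).neg_right
  exact X_pow_dvd_iff.1 this m h

/-- Triangularity: `diffSymbolSeries ^ l * A` starts with (-1)^l X^l, so the coefficients e_l vanish
one after the other. -/
lemma eq_zero_of_sum_dvd {A : ℝ⟦X⟧} (hA0 : constantCoeff A = 1) {n : ℕ} {e : ℕ → ℝ}
    (h : X ^ n ∣ (∑ l ∈ Finset.range n, C (e l) * diffSymbolSeries ^ l) * A) :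
    ∀ l < n, e l = 0 := by
  intro l
  induction l using Nat.strong_induction_on with
  | _ l ih =>
    intro hl
    have h1 := X_pow_dvd_iff.1 h l hl
    rw [Finset.sum_mul, map_sum, Finset.sum_eq_single l] at h1
    · rw [mul_assoc, coeff_C_mul, coeff_diffSymbolSeries_pow_mul, hA0] at h1
      simpa using h1
    · intro m hm hml
      rw [mul_assoc, coeff_C_mul]
      rcases lt_or_gt_of_ne hml with h2 | h2
      · rw [ih m h2 (h2.trans hl), zero_mul]
      · rw [coeff_diffSymbolSeries_pow_mul_of_lt h2, mul_zero]
    · intro h; exact absurd (Finset.mem_range.2 hl) h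

lemma sum_dvd_iff {α : ℝ} {A : ℝ⟦X⟧}
    (hA : sincSeries * d⁄dX ℝ A = C α * (d⁄dX ℝ sincSeries * A))
    (hA0 : constantCoeff A = 1) {n : ℕ} {c : ℕ → ℝ} :
    X ^ n ∣ (∑ l ∈ Finset.range n, C (c l) * diffSymbolSeries ^ l) * A - 1 ↔
      ∀ l < n, c l = compactCoeff α l := by
  have hb := sum_compactCoeff_dvd hA hA0 n
  constructor
  · intro h l hl
    refine sub_eq_zero.1 (eq_zero_of_sum_dvd hA0 (e := fun l => c l - compactCoeff α l) ?_ l hl)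
    convert dvd_sub h hb using 1
    simp only [map_sub, sub_mul, Finset.sum_sub_distrib]
    ring
  · intro h
    rwa [Finset.sum_congr rfl fun l hl => by rw [h l (Finset.mem_range.1 hl)]]

/-- The symbol of the central difference `δ_x^{2ℓ}`. -/
lemma sum_choose_mul_exp (l : ℕ) (θ : ℝ) :
    ∑ s ∈ Finset.range (2 * l + 1), (-1 : ℂ) ^ s * ((2 * l).choose s : ℂ) *
      Complex.exp (((l : ℝ) - (s : ℝ) : ℝ) * θ * Complex.I) =
    ((2 * Real.cos θ - 2 : ℝ) : ℂ) ^ l := by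
  set z := Complex.exp (θ * Complex.I) with hz
  have hz0 : z ≠ 0 := Complex.exp_ne_zero _
  have hcos : ((2 * Real.cos θ - 2 : ℝ) : ℂ) = (-1 + z) ^ 2 * z⁻¹ := by
    push_cast
    rw [Complex.cos, ← hz, neg_mul, Complex.exp_neg, ← hz]
    field_simp
    ring
  rw [hcos, mul_pow, ← pow_mul, add_pow, Finset.sum_mul]
  refine Finset.sum_congr rfl fun s hs => ?_
  have hs' : s ≤ 2 * l := by have := Finset.mem_range.1 hs; omega
  have e : Complex.exp (((l : ℝ) - (s : ℝ) : ℝ) * θ * Complex.I) = z ^ (2 * l - s) * z⁻¹ ^ l := by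
    rw [hz, ← Complex.exp_nat_mul, ← Complex.exp_neg, ← Complex.exp_nat_mul, ← Complex.exp_add]
    congr 1
    push_cast [Nat.cast_sub hs']
    ring
  rw [e]
  ring

lemma sum_choose_mul_cos (l : ℕ) (θ : ℝ) :
    ∑ s ∈ Finset.range (2 * l + 1), (-1 : ℝ) ^ s * ((2 * l).choose s : ℝ) *
      Real.cos (((l : ℝ) - (s : ℝ)) * θ) = (2 * Real.cos θ - 2) ^ l := by
  have h := congrArg Complex.re (sum_choose_mul_exp l θ)
  rw [← Complex.ofReal_pow, Complex.ofReal_re, Complex.re_sum] at h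
  rw [← h]
  refine Finset.sum_congr rfl fun s _ => ?_
  rw [show (-1 : ℂ) ^ s * ((2 * l).choose s : ℂ) =
    (((-1 : ℝ) ^ s * ((2 * l).choose s : ℝ) : ℝ) : ℂ) by push_cast; ring, Complex.re_ofReal_mul,
    ← Complex.ofReal_mul, Complex.exp_ofReal_mul_I_re]

/-- The terms s and 2l - s agree because cosine is even and the binomials are symmetric. This folded
sum is the shape that occurs in `IsCompactCoeff`. -/
lemma two_mul_sum_choose_mul_cos (l : ℕ) (θ : ℝ) :
    2 * (∑ s ∈ Finset.range l, (-1 : ℝ) ^ s * ((2 * l).choose s : ℝ) *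
      Real.cos (((l : ℝ) - (s : ℝ)) * θ)) + (-1) ^ l * ((2 * l).choose l : ℝ) =
      (2 * Real.cos θ - 2) ^ l := by
  rw [← sum_choose_mul_cos, show 2 * l + 1 = l + 1 + l by ring, Finset.sum_range_add,
    Finset.sum_range_succ, sub_self, zero_mul, Real.cos_zero, mul_one, two_mul, add_right_comm]
  congr 1
  rw [← Finset.sum_range_reflect]
  refine Finset.sum_congr rfl fun s hs => ?_
  have hs' := Finset.mem_range.1 hs
  have hc : (2 * l).choose (l + 1 + s) = (2 * l).choose (l - 1 - s) := by
    rw [← Nat.choose_symm (by omega : l - 1 - s ≤ 2 * l)]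
    congr 1
    omega
  have hp : (-1 : ℝ) ^ (l + 1 + s) = (-1) ^ (l - 1 - s) := by
    rw [show l + 1 + s = (l - 1 - s) + 2 * (s + 1) by omega, pow_add, pow_mul]
    norm_num
  rw [hc, hp, ← Real.cos_neg]
  congr 2
  rw [Nat.cast_sub (by omega), Nat.cast_sub (by omega)]
  push_cast
  ring

/-- The power series in `x = θ^2` of the symbol of `δ_x^{2ℓ}`, in the form used by
`IsCompactCoeff`. -/
def centralDiffSeries (l : ℕ) : ℝ⟦X⟧ :=
  C 2 * ∑ s ∈ Finset.range l, C ((-1) ^ s * ((2 * l).choose s : ℝ)) * cosSeries ((l : ℝ) - s) +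
    C ((-1) ^ l * ((2 * l).choose l : ℝ))

lemma hasEvenExpansion_diffSymbolSeries :
    HasEvenExpansion diffSymbolSeries fun θ => 2 * Real.cos θ - 2 := by
  refine (hasEvenExpansion_X.mul (hasEvenExpansion_sincSeries.pow 2)).neg.congr fun θ hθ => ?_
  have h := Real.sin_sq_eq_half_sub (θ / 2)
  rw [mul_div_cancel₀ θ two_ne_zero] at h
  field_simp
  linear_combination -2 * h

/-- Both sides expand the same function (2cos θ - 2)^l, and expansions are unique. -/
lemma centralDiffSeries_eq (l : ℕ) : centralDiffSeries l = diffSymbolSeries ^ l := by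
  have h : HasEvenExpansion (centralDiffSeries l) fun θ => (2 * Real.cos θ - 2) ^ l := by
    refine (((HasEvenExpansion.sum _ fun s _ => (hasEvenExpansion_cosSeries _).const_mul
      _).const_mul 2).add (HasEvenExpansion.const _)).congr fun θ _ => ?_
    exact two_mul_sum_choose_mul_cos l θ
  exact h.unique (hasEvenExpansion_diffSymbolSeries.pow l)

lemma sum_range_mul_eq_sum_coeff (F A : ℝ⟦X⟧) (n : ℕ) (y : ℝ) :
    ∑ q ∈ Finset.range n, ∑ p ∈ Finset.range (n - q), coeff q F * coeff p A * y ^ (q + p) =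
      ∑ m ∈ Finset.range n, coeff m (F * A) * y ^ m := by
  rw [← Finset.sum_range_diag_flip n fun q p => coeff q F * coeff p A * y ^ (q + p)]
  refine Finset.sum_congr rfl fun m _ => ?_
  rw [coeff_mul, Finset.Nat.sum_antidiagonal_eq_sum_range_succ_mk, Finset.sum_mul]
  refine Finset.sum_congr rfl fun k hk => ?_
  rw [Nat.add_sub_cancel' (Nat.lt_succ_iff.1 (Finset.mem_range.1 hk))]

/-- The triangle p + q < n cuts the Cauchy product off at degree n, so each bracket of the matching
equation is the truncation of `diffSymbolSeries ^ l * mk a`. -/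
lemma matching_summand (a : ℕ → ℝ) (n l : ℕ) (θ : ℝ) :
    2 * ∑ s ∈ Finset.range l, ∑ q ∈ Finset.range n, ∑ p ∈ Finset.range (n - q),
          (-1 : ℝ) ^ (s + q) * ((l : ℝ) - (s : ℝ)) ^ (2 * q) * ((2 * l).choose s : ℝ) * a p
            / ((2 * q).factorial : ℝ) * |θ| ^ (2 * (p + q))
        + (-1 : ℝ) ^ l * ((2 * l).choose l : ℝ) *
          ∑ p ∈ Finset.range n, a p * |θ| ^ (2 * p) =
      ∑ m ∈ Finset.range n, coeff m (diffSymbolSeries ^ l * mk a) * |θ| ^ (2 * m) := by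
  have e1 : ∀ s, ∑ q ∈ Finset.range n, ∑ p ∈ Finset.range (n - q),
      (-1 : ℝ) ^ (s + q) * ((l : ℝ) - (s : ℝ)) ^ (2 * q) * ((2 * l).choose s : ℝ) * a p
            / ((2 * q).factorial : ℝ) * |θ| ^ (2 * (p + q)) =
      ∑ m ∈ Finset.range n, coeff m (C ((-1) ^ s * ((2 * l).choose s : ℝ)) *
        cosSeries ((l : ℝ) - s) * mk a) * |θ| ^ (2 * m) := by
    intro s
    simp only [pow_mul |θ|]
    rw [← sum_range_mul_eq_sum_coeff]
    refine Finset.sum_congr rfl fun q _ => Finset.sum_congr rfl fun p _ => ?_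
    rw [coeff_C_mul, cosSeries, coeff_mk, coeff_mk, pow_add, add_comm p q]
    ring
  simp only [e1]
  rw [← centralDiffSeries_eq, centralDiffSeries, Finset.sum_comm, Finset.mul_sum, Finset.mul_sum,
    ← Finset.sum_add_distrib]
  refine Finset.sum_congr rfl fun m _ => ?_
  rw [add_mul, map_add, mul_assoc (C 2), coeff_C_mul, coeff_C_mul, Finset.sum_mul, map_sum,
    coeff_mk, ← Finset.sum_mul]
  ring

/-- Up to the sign (-1)^(n-1) this sum is the coefficient of X^(n-1) in `diffSymbolSeries ^ (n -
1)`. The middle binomial contributes only in degree 0, hence not here, since n ≥ 2. -/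
lemma matching_leading {n : ℕ} (hn : 2 ≤ n) :
    (∑ s ∈ Finset.range (n - 1), (-1 : ℝ) ^ s * ((2 * n - 2).choose s : ℝ) *
      (2 * ((n : ℝ) - 1 - (s : ℝ)) ^ (2 * n - 2) / ((2 * n - 2).factorial : ℝ))) = 1 := by
  have h1 := coeff_diffSymbolSeries_pow_mul (n - 1) 1
  rw [mul_one, ← centralDiffSeries_eq, centralDiffSeries, map_add, coeff_C_mul, map_sum, coeff_C,
    if_neg (by omega), map_one, mul_one, add_zero] at h1
  have hp : (-1 : ℝ) ^ (n - 1) * (-1) ^ (n - 1) = 1 := by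
    rw [← mul_pow]; norm_num
  refine Eq.trans ?_ ((congrArg ((-1 : ℝ) ^ (n - 1) * ·) h1).trans hp)
  simp only [Finset.mul_sum]
  refine Finset.sum_congr rfl fun s _ => ?_
  rw [coeff_C_mul, cosSeries, coeff_mk, show 2 * (n - 1) = 2 * n - 2 by omega,
    Nat.cast_sub (by omega)]
  push_cast
  linear_combination (-(-1 : ℝ) ^ s * ((2 * n - 2).choose s : ℝ) *
      (2 * ((n : ℝ) - 1 - (s : ℝ)) ^ (2 * n - 2) / ((2 * n - 2).factorial : ℝ))) * hp

lemma isCompactCoeff_iff {α : ℝ} {a : ℕ → ℝ} (ha : IsSincExpansion α a) {n : ℕ} (hn : 2 ≤ n)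
    (c : ℕ → ℝ) : IsCompactCoeff a n c ↔ ∀ l < n, c l = compactCoeff α l := by
  obtain ⟨hA0, hA⟩ := ha.spec
  rw [← sum_dvd_iff hA hA0, X_pow_dvd_iff]
  -- The matching equation says that `F` vanishes below degree n. The summand l = n - 1 truncates to
  -- the single monomial of degree n - 1 (`h3`), which is the term on the right side of the
  -- equation.
  set F := (∑ l ∈ Finset.range n, C (c l) * diffSymbolSeries ^ l) * mk a - 1 with hF
  have key : ∀ θ : ℝ, ∑ m ∈ Finset.range n, coeff m F * |θ| ^ (2 * m) =
      ∑ l ∈ Finset.range (n - 1), c l *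
      (2 * ∑ s ∈ Finset.range l, ∑ q ∈ Finset.range n, ∑ p ∈ Finset.range (n - q),
          (-1 : ℝ) ^ (s + q) * ((l : ℝ) - (s : ℝ)) ^ (2 * q) * ((2 * l).choose s : ℝ) * a p
            / ((2 * q).factorial : ℝ) * |θ| ^ (2 * (p + q))
        + (-1 : ℝ) ^ l * ((2 * l).choose l : ℝ) *
          ∑ p ∈ Finset.range n, a p * |θ| ^ (2 * p))
      - (1 - c (n - 1) * (-1 : ℝ) ^ (n - 1) * |θ| ^ (2 * n - 2)) := by
    intro θ
    simp only [matching_summand]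
    have h1 : ∑ m ∈ Finset.range n, coeff m F * |θ| ^ (2 * m) =
        ∑ l ∈ Finset.range n, c l * ∑ m ∈ Finset.range n,
          coeff m (diffSymbolSeries ^ l * mk a) * |θ| ^ (2 * m) - 1 := by
      have h2 : ∑ m ∈ Finset.range n, coeff m (1 : ℝ⟦X⟧) * |θ| ^ (2 * m) = 1 := by
        rw [Finset.sum_eq_single 0]
        · simp
        · intro m _ hm; rw [coeff_one, if_neg hm, zero_mul]
        · intro h; exact absurd (Finset.mem_range.2 (by omega)) h
      rw [← h2]
      simp only [Finset.mul_sum]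
      rw [Finset.sum_comm, ← Finset.sum_sub_distrib]
      refine Finset.sum_congr rfl fun m _ => ?_
      rw [hF, map_sub, sub_mul, Finset.sum_mul, map_sum, Finset.sum_mul]
      congr 1
      refine Finset.sum_congr rfl fun l _ => ?_
      rw [mul_assoc, coeff_C_mul, mul_assoc]
    have h3 : ∑ m ∈ Finset.range n,
        coeff m (diffSymbolSeries ^ (n - 1) * mk a) * |θ| ^ (2 * m) =
        (-1) ^ (n - 1) * |θ| ^ (2 * n - 2) := by
      rw [Finset.sum_eq_single (n - 1)]
      · rw [coeff_diffSymbolSeries_pow_mul, hA0, mul_one, show 2 * (n - 1) = 2 * n - 2 by omega]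
      · intro m hm hmn
        have := Finset.mem_range.1 hm
        rw [coeff_diffSymbolSeries_pow_mul_of_lt (by omega), zero_mul]
      · intro h; exact absurd (Finset.mem_range.2 (by omega)) h
    have h4 := Finset.sum_range_succ (fun l => c l * ∑ m ∈ Finset.range n,
      coeff m (diffSymbolSeries ^ l * mk a) * |θ| ^ (2 * m)) (n - 1)
    rw [show n - 1 + 1 = n by omega] at h4
    rw [h1, h4, h3]
    ring
  have hiff : IsCompactCoeff a n c ↔
      ∀ θ : ℝ, ∑ m ∈ Finset.range n, coeff m F * |θ| ^ (2 * m) = 0 := by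
    simp only [IsCompactCoeff, matching_leading hn, mul_one]
    exact forall_congr' fun θ => by rw [key θ, sub_eq_zero]
  rw [hiff]
  constructor
  · intro h m hm
    have h1 : HasEvenExpansion (mk fun m => if m < n then coeff m F else 0) fun _ => 0 := by
      refine (HasEvenExpansion.of_poly (n := n) fun m hm => ?_).congr fun θ _ => ?_
      · rw [coeff_mk, if_neg (by omega)]
      · rw [← h θ]
        refine Finset.sum_congr rfl fun m hm => ?_
        rw [coeff_mk, if_pos (Finset.mem_range.1 hm)]
    have := congrArg (coeff m) h1.coeff_eq_zero_of_zero
    simpa [hm] using this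
  · intro h θ
    exact Finset.sum_eq_zero fun m hm => by rw [h m (Finset.mem_range.1 hm), zero_mul]

lemma compactCoeff_values (α : ℝ) : compactCoeff α 0 = 1 ∧ compactCoeff α 1 = -α / 24 ∧
    compactCoeff α 2 = (11 / 2880 + α / 1152) * α ∧
    compactCoeff α 3 = -(191 / 362880 + 11 * α / 69120 + α ^ 2 / 82944) * α ∧
    compactCoeff α 4 = (2497 / 29030400 + 10181 * α / 348364800 + 11 * α ^ 2 / 3317760
            + α ^ 3 / 7962624) * α := by
  -- Solving L·A = A' gives the coefficients 1/6, 11/90, 191/1890, 2497/28350 of the logarithmic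
  -- derivative L; these feed the recursion for the α-th power.
  have e : ∀ n, ∑ k ∈ Finset.range (n + 1), coeff k arcsinLogDeriv * coeff (n - k) arcsinSeries =
      coeff (n + 1) arcsinSeries * (n + 1) := by
    intro n
    have := congrArg (coeff n) arcsinLogDeriv_mul
    rwa [coeff_mul, coeff_derivative, Finset.Nat.sum_antidiagonal_eq_sum_range_succ_mk] at this
  have e0 := e 0
  have e1 := e 1
  have e2 := e 2
  have e3 := e 3
  simp only [Finset.sum_range_succ, Finset.sum_range_zero, coeff_arcsinSeries,
    invSqrtCoeff] at e0 e1 e2 e3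
  norm_num [invSqrtCoeff, -coeff_zero_eq_constantCoeff] at e0 e1 e2 e3
  rw [e0] at e1 e2 e3
  have r1 : coeff 1 arcsinLogDeriv = 11 / 90 := by linarith
  rw [r1] at e2 e3
  have r2 : coeff 2 arcsinLogDeriv = 191 / 1890 := by linarith
  rw [r2] at e3
  have r3 : coeff 3 arcsinLogDeriv = 2497 / 28350 := by linarith
  have c0 : arcsinPowCoeff α 0 = 1 := by simp [arcsinPowCoeff]
  have c1 := arcsinPowCoeff_succ α 0
  have c2 := arcsinPowCoeff_succ α 1
  have c3 := arcsinPowCoeff_succ α 2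
  have c4 := arcsinPowCoeff_succ α 3
  simp only [Finset.sum_range_succ, Finset.sum_range_zero, c0] at c1 c2 c3 c4
  norm_num [-coeff_zero_eq_constantCoeff, e0, r1, r2, r3] at c1 c2 c3 c4
  rw [c1] at c2 c3 c4
  rw [c2] at c3 c4
  rw [c3] at c4
  refine ⟨by simp [compactCoeff, c0], ?_, ?_, ?_, ?_⟩
  · rw [compactCoeff, c1]; ring
  · rw [compactCoeff, c2]; ring
  · rw [compactCoeff, c3]; ring
  · rw [compactCoeff, c4]; ring

lemma abs_compactCoeff_mul_lt_one {α : ℝ} (hα : 0 ≤ α) (h2 : α ≤ 2) {l : ℕ} (hl : l ≠ 0) :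
    |compactCoeff α l| * 4 ^ l < 1 := by
  have e : |compactCoeff α l| * 4 ^ l = arcsinPowCoeff α l := by
    rw [compactCoeff, abs_mul, abs_pow, abs_of_nonneg (arcsinPowCoeff_nonneg hα l), mul_right_comm,
      ← mul_pow]
    norm_num
  rw [e]
  exact arcsinPowCoeff_lt_one hα h2 hl

end RieszCompact

/-! ### Inverting the compact operator on bounded functions. -/

namespace RieszCompact

lemma centralDiff_zero (h : ℝ) (v : ℝ → ℝ) (x : ℝ) : centralDiff h 0 v x = v x := by
  simp [centralDiff]

lemma centralDiff_sub (h : ℝ) (l : ℕ) (v w : ℝ → ℝ) (x : ℝ) :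
    centralDiff h l (v - w) x = centralDiff h l v x - centralDiff h l w x := by
  simp [centralDiff, mul_sub, Finset.sum_sub_distrib]

lemma sum_choose_two_mul (l : ℕ) :
    ∑ s ∈ Finset.range (2 * l + 1), ((2 * l).choose s : ℝ) = 4 ^ l := by
  have := Nat.sum_range_choose (2 * l)
  rw [pow_mul] at this
  exact_mod_cast this

lemma abs_centralDiff_le {h : ℝ} {l : ℕ} {v : ℝ → ℝ} {M : ℝ} (hv : ∀ x, |v x| ≤ M) (x : ℝ) :
    |centralDiff h l v x| ≤ 4 ^ l * M := by
  rw [← sum_choose_two_mul, Finset.sum_mul]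
  refine (Finset.abs_sum_le_sum_abs _ _).trans (Finset.sum_le_sum fun s _ => ?_)
  rw [abs_mul, abs_mul, abs_pow, abs_neg, abs_one, one_pow, one_mul, Nat.abs_cast]
  gcongr
  exact hv _

lemma compactOp_apply (n : ℕ) (b : ℕ → ℝ) (h : ℝ) (v : ℝ → ℝ) (x : ℝ) :
    compactOp n b h v x = v x - b (n - 1) * centralDiff h (n - 1) v x := by
  rw [compactOp, centralDiff_zero]

lemma compactOp_sub (n : ℕ) (b : ℕ → ℝ) (h : ℝ) (v w : ℝ → ℝ) :
    compactOp n b h (v - w) = compactOp n b h v - compactOp n b h w := by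
  ext x
  simp only [compactOp_apply, Pi.sub_apply, centralDiff_sub]
  ring

section

variable {n : ℕ} {b : ℕ → ℝ} {h : ℝ}

lemma abs_mul_centralDiff_le {v : ℝ → ℝ} {M : ℝ} (hv : ∀ x, |v x| ≤ M) (x : ℝ) :
    |b (n - 1) * centralDiff h (n - 1) v x| ≤ |b (n - 1)| * 4 ^ (n - 1) * M := by
  rw [abs_mul, mul_assoc]
  gcongr
  exact abs_centralDiff_le hv x

/-- The supremum S of |v| satisfies S ≤ K + qS with q = |b_{n-1}| 4^(n-1) < 1. Boundedness of `v`
makes S finite. -/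
lemma abs_le_of_compactOp (hb : |b (n - 1)| * 4 ^ (n - 1) < 1) {v : ℝ → ℝ} (hv : v ∈ boundedFun)
    {K : ℝ} (hK : ∀ x, |compactOp n b h v x| ≤ K) (x : ℝ) :
    |v x| ≤ K / (1 - |b (n - 1)| * 4 ^ (n - 1)) := by
  obtain ⟨M₀, hM₀⟩ := hv
  have hbdd : BddAbove (Set.range fun x => |v x|) := ⟨M₀, by rintro _ ⟨x, rfl⟩; exact hM₀ x⟩
  have hM : ∀ x, |v x| ≤ ⨆ x, |v x| := le_ciSup hbdd
  have h1 : ⨆ x, |v x| ≤ K + |b (n - 1)| * 4 ^ (n - 1) * ⨆ x, |v x| := by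
    refine ciSup_le fun y => ?_
    have e : v y = compactOp n b h v y + b (n - 1) * centralDiff h (n - 1) v y := by
      rw [compactOp_apply]; ring
    rw [e]
    exact (abs_add_le _ _).trans (add_le_add (hK y) (abs_mul_centralDiff_le hM y))
  refine (hM x).trans ?_
  rw [le_div_iff₀ (by linarith)]
  linarith

lemma compactOp_bijOn (hb : |b (n - 1)| * 4 ^ (n - 1) < 1) :
    Set.BijOn (compactOp n b h) boundedFun boundedFun := by
  set q := |b (n - 1)| * 4 ^ (n - 1) with hq
  have hq0 : 0 ≤ q := by positivity
  refine ⟨?_, ?_, ?_⟩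
  · rintro v ⟨M, hM⟩
    refine ⟨M + q * M, fun x => ?_⟩
    rw [compactOp_apply]
    exact (abs_sub _ _).trans (add_le_add (hM x) (abs_mul_centralDiff_le hM x))
  · rintro v ⟨M, hM⟩ w ⟨N, hN⟩ hvw
    have hd : v - w ∈ boundedFun :=
      ⟨M + N, fun x => (abs_sub _ _).trans (add_le_add (hM x) (hN x))⟩
    have h0 := abs_le_of_compactOp (h := h) hb hd (K := 0) fun x => by
      rw [compactOp_sub, hvw, sub_self]; simp
    ext x
    have := h0 x
    rw [zero_div] at this
    exact sub_eq_zero.1 (abs_nonpos_iff.1 this)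
  · rintro f ⟨M, hM⟩
    -- Neumann series: the operator is 1 - `L`, iterates of `L` decay like q^k, and the sum of
    -- `L^[k] f` is a bounded preimage of `f`.
    set L : (ℝ → ℝ) → (ℝ → ℝ) := fun v x => b (n - 1) * centralDiff h (n - 1) v x with hL
    have hit : ∀ k x, |L^[k] f x| ≤ M * q ^ k := by
      intro k
      induction k with
      | zero => simpa using hM
      | succ k ih =>
        intro x
        rw [Function.iterate_succ_apply']
        refine (abs_mul_centralDiff_le ih x).trans (le_of_eq ?_)
        rw [← hq]; ring
    have hsum : ∀ x, Summable fun k => L^[k] f x := fun x =>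
      Summable.of_norm_bounded ((summable_geometric_of_lt_one hq0 hb).mul_left M)
        fun k => hit k x
    refine ⟨fun x => ∑' k, L^[k] f x, ⟨M * (1 - q)⁻¹, fun x => ?_⟩, ?_⟩
    · exact tsum_of_norm_bounded (f := fun k => L^[k] f x) ((hasSum_geometric_of_lt_one hq0 hb).mul_left M)
        fun k => hit k x
    · ext x
      have hLs : b (n - 1) * centralDiff h (n - 1) (fun x => ∑' k, L^[k] f x) x =
          ∑' k, L^[k + 1] f x := by
        have e : ∀ k, L^[k + 1] f x = b (n - 1) * centralDiff h (n - 1) (L^[k] f) x := fun k => by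
          rw [Function.iterate_succ_apply']
        simp only [e, centralDiff]
        rw [tsum_mul_left, Summable.tsum_finsetSum fun s _ => (hsum _).mul_left _]
        simp only [tsum_mul_left]
      rw [compactOp_apply, hLs, (hsum x).tsum_eq_zero_add]
      simp

/-- Stability: a residual of size `K` in the compact equation moves the solution by at most K/(1 -
q), a factor independent of h. -/
lemma abs_sub_compactInv_le (hb : |b (n - 1)| * 4 ^ (n - 1) < 1) {v f : ℝ → ℝ}
    (hv : v ∈ boundedFun) (hf : f ∈ boundedFun)
    {K : ℝ} (hK : ∀ x, |compactOp n b h v x - f x| ≤ K) (x : ℝ) :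
    |v x - compactInv n b h f x| ≤ K / (1 - |b (n - 1)| * 4 ^ (n - 1)) := by
  obtain ⟨w, hw, hwf⟩ := (compactOp_bijOn (h := h) hb).surjOn hf
  have hmem : compactInv n b h f ∈ boundedFun := Function.invFunOn_mem ⟨w, hw, hwf⟩
  have heq : compactOp n b h (compactInv n b h f) = f := Function.invFunOn_eq ⟨w, hw, hwf⟩
  obtain ⟨M, hM⟩ := hv
  obtain ⟨N, hN⟩ := hmem
  have hd : v - compactInv n b h f ∈ boundedFun :=
    ⟨M + N, fun x => (abs_sub _ _).trans (add_le_add (hM x) (hN x))⟩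
  refine abs_le_of_compactOp (h := h) hb hd (fun y => ?_) x
  rw [compactOp_sub, heq]
  exact hK y

end

end RieszCompact

/-! ### Functions given by Fourier integrals, and decay of Fourier transforms. -/

namespace RieszCompact

open MeasureTheory Filter FourierTransform

/-- The real function `v` is the inverse Fourier integral of the integrable function `φ`. -/
def IsFourierInt (φ : ℝ → ℂ) (v : ℝ → ℝ) : Prop :=
  Integrable φ ∧ ∀ x : ℝ, (v x : ℂ) = ∫ ω : ℝ, Complex.exp ((2 * Real.pi * ω * x : ℝ) * Complex.I) * φ ω

lemma integrable_exp_mul {φ : ℝ → ℂ} (hφ : Integrable φ) (x : ℝ) :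
    Integrable fun ω : ℝ => Complex.exp ((2 * Real.pi * ω * x : ℝ) * Complex.I) * φ ω := by
  refine hφ.bdd_mul (c := 1) (Continuous.aestronglyMeasurable (by fun_prop)) ?_
  exact Eventually.of_forall fun ω => (Complex.norm_exp_ofReal_mul_I _).le

namespace IsFourierInt

variable {φ ψ : ℝ → ℂ} {v w : ℝ → ℝ}

lemma abs_le (hv : IsFourierInt φ v) (x : ℝ) : |v x| ≤ ∫ ω, ‖φ ω‖ := by
  rw [← Real.norm_eq_abs, ← Complex.norm_real, hv.2 x]
  refine (norm_integral_le_integral_norm _).trans (le_of_eq ?_)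
  refine integral_congr_ae (Eventually.of_forall fun ω => ?_)
  simp only [norm_mul, Complex.norm_exp_ofReal_mul_I, one_mul]

lemma mem_boundedFun (hv : IsFourierInt φ v) : v ∈ boundedFun := ⟨_, hv.abs_le⟩

lemma sub (hv : IsFourierInt φ v) (hw : IsFourierInt ψ w) :
    IsFourierInt (fun ω => φ ω - ψ ω) fun x => v x - w x := by
  refine ⟨hv.1.sub hw.1, fun x => ?_⟩
  simp only [mul_sub]
  rw [integral_sub (integrable_exp_mul hv.1 x) (integrable_exp_mul hw.1 x), ← hv.2, ← hw.2]
  push_cast; rfl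

lemma const_mul (hv : IsFourierInt φ v) (r : ℝ) :
    IsFourierInt (fun ω => (r : ℂ) * φ ω) fun x => r * v x := by
  refine ⟨hv.1.const_mul _, fun x => ?_⟩
  simp only [mul_left_comm _ (r : ℂ)]
  rw [integral_const_mul, ← hv.2]
  push_cast; rfl

lemma sum {ι : Type*} (s : Finset ι) {φ : ι → ℝ → ℂ} {v : ι → ℝ → ℝ}
    (h : ∀ i ∈ s, IsFourierInt (φ i) (v i)) :
    IsFourierInt (fun ω => ∑ i ∈ s, φ i ω) fun x => ∑ i ∈ s, v i x := by
  refine ⟨integrable_finsetSum s fun i hi => (h i hi).1, fun x => ?_⟩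
  simp only [Finset.mul_sum]
  rw [integral_finsetSum s fun i hi => integrable_exp_mul (h i hi).1 x, Complex.ofReal_sum]
  exact Finset.sum_congr rfl fun i hi => (h i hi).2 x

lemma congr (hv : IsFourierInt φ v) (h : ∀ ω, φ ω = ψ ω) : IsFourierInt ψ v := by
  rwa [← funext h]

lemma shift (hv : IsFourierInt φ v) (c : ℝ) :
    IsFourierInt (fun ω => Complex.exp ((2 * Real.pi * ω * c : ℝ) * Complex.I) * φ ω)
      fun x => v (x + c) := by
  refine ⟨integrable_exp_mul hv.1 c, fun x => ?_⟩
  rw [hv.2]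
  refine integral_congr_ae (Eventually.of_forall fun ω => ?_)
  simp only
  rw [← mul_assoc, ← Complex.exp_add]
  congr 2
  push_cast
  ring

lemma centralDiff (hv : IsFourierInt φ v) (h : ℝ) (l : ℕ) :
    IsFourierInt (fun ω => (((2 * Real.cos (2 * Real.pi * ω * h) - 2) ^ l : ℝ) : ℂ) * φ ω)
      (centralDiff h l v) := by
  have := IsFourierInt.sum (Finset.range (2 * l + 1)) fun s _ =>
    (hv.shift (((l : ℝ) - (s : ℝ)) * h)).const_mul ((-1 : ℝ) ^ s * ((2 * l).choose s : ℝ))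
  refine this.congr fun ω => ?_
  rw [Complex.ofReal_pow, ← sum_choose_mul_exp, Finset.sum_mul]
  refine Finset.sum_congr rfl fun s _ => ?_
  push_cast
  rw [← mul_assoc]
  congr 3
  ring

end IsFourierInt

lemma integrableOn_abs_rpow {r : ℝ} (hr : -1 < r) :
    IntegrableOn (fun x : ℝ => |x| ^ r) (Set.Icc (-1) 1) := by
  have h1 : IntervalIntegrable (fun x : ℝ => |x| ^ r) volume 0 1 := by
    refine (intervalIntegral.intervalIntegrable_rpow' hr).congr fun x hx => ?_
    rw [Set.uIoc_of_le zero_le_one] at hx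
    simp only [abs_of_pos hx.1]
  have h2 : IntervalIntegrable (fun x : ℝ => |x| ^ r) volume (-1) 0 := by
    have := ((IntervalIntegrable.iff_comp_neg (by simp)).1 h1).symm
    simpa using this
  have := h2.trans h1
  rwa [intervalIntegrable_iff_integrableOn_Icc_of_le (by norm_num)] at this

/-- On [-1, 1] the function is bounded and the power is integrable since r > -1; outside, the power
is at most 1. -/
lemma integrable_abs_rpow_mul {f : ℝ → ℂ} (hf : Integrable f) {M : ℝ} (hM : ∀ x, ‖f x‖ ≤ M)
    {r : ℝ} (hr : -1 < r) (hr0 : r ≤ 0) : Integrable fun x => ((|x| ^ r : ℝ) : ℂ) * f x := by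
  have h1 : Integrable fun x : ℝ => M * (Set.Icc (-1 : ℝ) 1).indicator (fun x : ℝ => |x| ^ r) x :=
    ((integrable_indicator_iff measurableSet_Icc).2 (integrableOn_abs_rpow hr)).const_mul M
  refine (h1.add hf.norm).mono' ?_ (Eventually.of_forall fun x => ?_)
  · exact (Measurable.aestronglyMeasurable (by fun_prop)).mul hf.1
  · have hM0 : 0 ≤ M := (norm_nonneg _).trans (hM 0)
    have hx : (0 : ℝ) ≤ |x| ^ r := by positivity
    rw [norm_mul, Complex.norm_real, Real.norm_eq_abs, abs_of_nonneg hx]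
    simp only [Pi.add_apply]
    by_cases h : x ∈ Set.Icc (-1 : ℝ) 1
    · rw [Set.indicator_of_mem h]
      have := mul_le_mul_of_nonneg_left (hM x) hx
      linarith [norm_nonneg (f x)]
    · rw [Set.indicator_of_notMem h, mul_zero, zero_add]
      refine mul_le_of_le_one_left (norm_nonneg _) (Real.rpow_le_one_of_one_le_of_nonpos ?_ hr0)
      by_contra h1
      exact h ⟨by linarith [neg_abs_le x], by linarith [le_abs_self x]⟩

lemma iteratedDeriv_ofReal_comp {u : ℝ → ℝ} {k : ℕ} :
    ∀ {N : ℕ}, ContDiff ℝ N u → k ≤ N →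
      iteratedDeriv k (fun x => (u x : ℂ)) = fun x => ((iteratedDeriv k u x : ℝ) : ℂ) := by
  induction k with
  | zero => intro N _ _; simp
  | succ k ih =>
    intro N hu hk
    rw [iteratedDeriv_succ, ih hu (by omega)]
    ext x
    have hd : DifferentiableAt ℝ (iteratedDeriv k u) x :=
      (hu.differentiable_iteratedDeriv k (by exact_mod_cast hk)) x
    rw [iteratedDeriv_succ]
    exact hd.hasDerivAt.ofReal_comp.deriv

lemma norm_fourier_le (f : ℝ → ℂ) (ω : ℝ) : ‖𝓕 f ω‖ ≤ ∫ x, ‖f x‖ :=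
  VectorFourier.norm_fourierIntegral_le_integral_norm _ _ _ _ _

/-- The Fourier transform of a real function. -/
def fourierReal (u : ℝ → ℝ) : ℝ → ℂ := 𝓕 fun x => (u x : ℂ)

lemma norm_fourierReal_le {u : ℝ → ℝ} {N : ℕ} (hu : ContDiff ℝ N u)
    (hd : Differentiable ℝ (iteratedDeriv N u))
    (hi : ∀ k ≤ N + 1, Integrable (iteratedDeriv k u)) :
    ∃ K, 0 ≤ K ∧ ∀ ω, ‖fourierReal u ω‖ ≤ K * (1 + |ω|) ^ (-((N : ℝ) + 1)) := by
  set U : ℝ → ℂ := fun x => (u x : ℂ) with hU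
  have hUc : ContDiff ℝ N U := Complex.ofRealCLM.contDiff.comp hu
  have hUi : ∀ k ≤ N, Integrable (iteratedDeriv k U) := fun k hk => by
    rw [iteratedDeriv_ofReal_comp hu hk]
    exact (hi k (by omega)).ofReal
  have e1 : 𝓕 (iteratedDeriv N U) = fun ω : ℝ => (2 * Real.pi * Complex.I * ω) ^ N • 𝓕 U ω :=
    Real.fourier_iteratedDeriv (N := N) (n := N) (by exact_mod_cast hUc)
      (fun k hk => hUi k (by exact_mod_cast hk)) le_rfl
  -- The derivative of order N + 1 is treated on its own, because it is only assumed to exist and be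
  -- integrable, not to be continuous.
  have hdU : deriv (iteratedDeriv N U) = fun x => ((iteratedDeriv (N + 1) u x : ℝ) : ℂ) := by
    rw [iteratedDeriv_ofReal_comp hu le_rfl]
    ext x
    rw [iteratedDeriv_succ]
    exact (hd x).hasDerivAt.ofReal_comp.deriv
  have hdU' : Differentiable ℝ (iteratedDeriv N U) := by
    rw [iteratedDeriv_ofReal_comp hu le_rfl]
    exact fun x => (hd x).hasDerivAt.ofReal_comp.differentiableAt
  have e2 := Real.fourier_deriv (hUi N le_rfl) hdU' (by rw [hdU]; exact (hi _ le_rfl).ofReal)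
  set K₁ := ∫ x, ‖deriv (iteratedDeriv N U) x‖
  set K₀ := ∫ x, ‖U x‖
  have b0 : ∀ ω, ‖fourierReal u ω‖ ≤ K₀ := fun ω => norm_fourier_le U ω
  have b1 : ∀ ω, |ω| ^ (N + 1) * ‖fourierReal u ω‖ ≤ K₁ := fun ω => by
    have h := norm_fourier_le (deriv (iteratedDeriv N U)) ω
    rw [e2, e1] at h
    simp only [norm_smul, norm_mul, norm_pow, Complex.norm_I, Complex.norm_real, mul_one,
      Complex.norm_ofNat, Real.norm_eq_abs, abs_of_pos Real.pi_pos] at h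
    have h2 : (1 : ℝ) ≤ 2 * Real.pi := by linarith [Real.pi_gt_three]
    refine le_trans ?_ h
    rw [← mul_assoc, ← pow_succ', mul_pow]
    change _ ≤ (2 * Real.pi) ^ (N + 1) * |ω| ^ (N + 1) * ‖fourierReal u ω‖
    rw [mul_assoc]
    exact le_mul_of_one_le_left (by positivity) (one_le_pow₀ h2)
  have hK0 : 0 ≤ K₀ := (norm_nonneg _).trans (b0 0)
  have hK1 : 0 ≤ K₁ := le_trans (by positivity) (b1 0)
  refine ⟨2 ^ (N + 1) * (K₀ + K₁), by positivity, fun ω => ?_⟩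
  have hp : (0 : ℝ) < 1 + |ω| := by positivity
  rw [show -((N : ℝ) + 1) = -((N + 1 : ℕ) : ℝ) by push_cast; ring, Real.rpow_neg hp.le,
    Real.rpow_natCast, ← div_eq_mul_inv, le_div_iff₀ (by positivity)]
  have hm : (1 + |ω|) ^ (N + 1) ≤ 2 ^ (N + 1) * (1 + |ω| ^ (N + 1)) := by
    rcases le_total |ω| 1 with h | h
    · calc (1 + |ω|) ^ (N + 1) ≤ 2 ^ (N + 1) := by gcongr; linarith
        _ ≤ _ := le_mul_of_one_le_right (by positivity) (by
          have : 0 ≤ |ω| ^ (N + 1) := by positivity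
          linarith)
    · calc (1 + |ω|) ^ (N + 1) ≤ (2 * |ω|) ^ (N + 1) := by gcongr; linarith
        _ = 2 ^ (N + 1) * |ω| ^ (N + 1) := mul_pow _ _ _
        _ ≤ _ := by gcongr; linarith
  calc ‖fourierReal u ω‖ * (1 + |ω|) ^ (N + 1)
      ≤ ‖fourierReal u ω‖ * (2 ^ (N + 1) * (1 + |ω| ^ (N + 1))) := by gcongr
    _ = 2 ^ (N + 1) * (‖fourierReal u ω‖ + |ω| ^ (N + 1) * ‖fourierReal u ω‖) := by ring
    _ ≤ _ := by gcongr; exacts [b0 ω, b1 ω]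

lemma continuous_fourierReal {u : ℝ → ℝ} (hu : Integrable u) : Continuous (fourierReal u) :=
  VectorFourier.fourierIntegral_continuous Real.continuous_fourierChar
    (by exact continuous_inner) hu.ofReal

lemma integrable_abs_rpow_mul_of_decay {f : ℝ → ℂ} (hf : Continuous f) {K p : ℝ}
    (hK : ∀ ω, ‖f ω‖ ≤ K * (1 + |ω|) ^ (-p)) {r : ℝ} (hr0 : 0 ≤ r) (hr : r < p - 1) :
    Integrable fun ω => ((|ω| ^ r : ℝ) : ℂ) * f ω := by
  have h1 : Integrable fun ω : ℝ => K * (1 + ‖ω‖) ^ (-(p - r)) :=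
    (integrable_one_add_norm (by simp; linarith)).const_mul K
  refine h1.mono' ?_ (Eventually.of_forall fun ω => ?_)
  · exact (Measurable.aestronglyMeasurable (by fun_prop)).mul hf.aestronglyMeasurable
  · have hp : (0 : ℝ) < 1 + |ω| := by positivity
    have hx : (0 : ℝ) ≤ |ω| ^ r := by positivity
    rw [norm_mul, Complex.norm_real, Real.norm_eq_abs, abs_of_nonneg hx, Real.norm_eq_abs,
      show -(p - r) = r + -p by ring, Real.rpow_add hp]
    calc |ω| ^ r * ‖f ω‖ ≤ (1 + |ω|) ^ r * (K * (1 + |ω|) ^ (-p)) := by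
          gcongr
          · linarith
          · exact hK ω
      _ = _ := by ring

lemma isFourierInt_fourierReal {u : ℝ → ℝ} (hc : Continuous u) (hu : Integrable u)
    (hF : Integrable (fourierReal u)) : IsFourierInt (fourierReal u) u := by
  refine ⟨hF, fun x => ?_⟩
  have h := Continuous.fourierInv_fourier_eq (f := fun x => (u x : ℂ)) (by fun_prop) hu.ofReal hF
  have h' := congrFun h x
  rw [← h', Real.fourierInv_eq']
  refine integral_congr_ae (Eventually.of_forall fun ω => ?_)
  simp only [smul_eq_mul, fourierReal]
  congr 3
  simp only [RCLike.inner_apply, conj_trivial]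
  push_cast
  ring

end RieszCompact

/-! ### The coefficients g_k as Fourier coefficients of |2 sin(θ/2)|^α. -/

namespace RieszCompact

open MeasureTheory Filter

lemma integral_mul_one_sub_rpow {a : ℝ} (ha : 0 < a) :
    ∫ x in (0 : ℝ)..1, (x * (1 - x)) ^ (a - 1) = Real.Gamma a ^ 2 / Real.Gamma (2 * a) := by
  have h := Complex.Gamma_mul_Gamma_eq_betaIntegral (s := a) (t := a) (by simpa) (by simpa)
  have hb : Complex.betaIntegral a a =
      ((∫ x in (0 : ℝ)..1, (x * (1 - x)) ^ (a - 1) : ℝ) : ℂ) := by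
    rw [Complex.betaIntegral, ← intervalIntegral.integral_ofReal]
    refine intervalIntegral.integral_congr fun x hx => ?_
    rw [Set.uIcc_of_le zero_le_one] at hx
    have h1 : 0 ≤ 1 - x := by linarith [hx.2]
    rw [Real.mul_rpow hx.1 h1, Complex.ofReal_mul, Complex.ofReal_cpow hx.1,
      Complex.ofReal_cpow h1]
    push_cast
    rfl
  rw [hb, ← Complex.ofReal_add, Complex.Gamma_ofReal, Complex.Gamma_ofReal, ← two_mul] at h
  have h' : Real.Gamma a * Real.Gamma a =
      Real.Gamma (2 * a) * ∫ x in (0 : ℝ)..1, (x * (1 - x)) ^ (a - 1) := by exact_mod_cast h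
  rw [pow_two, h', mul_div_cancel_left₀ _ (Real.Gamma_pos_of_pos (by linarith)).ne']

lemma sin_half_nonneg {θ : ℝ} (h : θ ∈ Set.uIcc 0 (2 * Real.pi)) : 0 ≤ Real.sin (θ / 2) := by
  rw [Set.uIcc_of_le Real.two_pi_pos.le] at h
  exact Real.sin_nonneg_of_nonneg_of_le_pi (by linarith [h.1]) (by linarith [h.2])

lemma integral_two_mul_sin_half_rpow {α : ℝ} (hα : 1 < α) :
    ∫ θ in (0 : ℝ)..2 * Real.pi, (2 * Real.sin (θ / 2)) ^ α =
      2 * Real.pi * (Real.Gamma (α + 1) / Real.Gamma (α / 2 + 1) ^ 2) := by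
  -- The substitution x = (1 - cos(θ/2))/2 gives x(1 - x) = (sin(θ/2)/2)² and turns the integral
  -- into a symmetric beta integral; the duplication formula `hd` then simplifies the Gamma factors.
  have hs := intervalIntegral.integral_comp_mul_deriv (a := 0) (b := 2 * Real.pi)
    (f := fun θ => (1 - Real.cos (θ / 2)) / 2) (f' := fun θ => Real.sin (θ / 2) / 4)
    (g := fun x => (x * (1 - x)) ^ ((α + 1) / 2 - 1))
    (fun θ _ => by
      have h1 : HasDerivAt (fun θ : ℝ => θ / 2) (1 / 2) θ := (hasDerivAt_id θ).div_const 2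
      have h2 := (((Real.hasDerivAt_cos (θ / 2)).comp θ h1).const_sub 1).div_const 2
      convert! h2 using 1
      ring)
    (Continuous.continuousOn (by fun_prop))
    (Continuous.rpow_const (by fun_prop) fun x => Or.inr (by linarith))
  have e : ∫ θ in (0 : ℝ)..2 * Real.pi, (2 * Real.sin (θ / 2)) ^ α = ∫ θ in (0 : ℝ)..2 * Real.pi,
      2 * 4 ^ α * (((fun x : ℝ => (x * (1 - x)) ^ ((α + 1) / 2 - 1)) ∘
        fun θ => (1 - Real.cos (θ / 2)) / 2) θ * (Real.sin (θ / 2) / 4)) := by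
    refine intervalIntegral.integral_congr fun θ hθ => ?_
    have h0 := sin_half_nonneg hθ
    have h1 : (1 - Real.cos (θ / 2)) / 2 * (1 - (1 - Real.cos (θ / 2)) / 2) =
        (Real.sin (θ / 2) / 2) ^ (2 : ℝ) := by
      rw [Real.rpow_two, div_pow, Real.sin_sq]; ring
    simp only [Function.comp_apply]
    rw [h1, ← Real.rpow_mul (by positivity),
      show (2 : ℝ) * ((α + 1) / 2 - 1) = α - 1 by ring]
    have h2 : (Real.sin (θ / 2) / 2) ^ α =
        (Real.sin (θ / 2) / 2) ^ (α - 1) * (Real.sin (θ / 2) / 2) := by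
      rw [← Real.rpow_add_one' (by positivity) (by linarith), sub_add_cancel]
    have h3 : (2 * Real.sin (θ / 2)) ^ α = 4 ^ α * (Real.sin (θ / 2) / 2) ^ α := by
      rw [← Real.mul_rpow (by norm_num) (by positivity)]
      congr 1
      ring
    rw [h3, h2]
    ring
  rw [e, intervalIntegral.integral_const_mul, hs]
  have hlo : (1 - Real.cos (0 / 2)) / 2 = 0 := by simp
  have hhi : (1 - Real.cos (2 * Real.pi / 2)) / 2 = 1 := by
    rw [mul_div_cancel_left₀ _ two_ne_zero, Real.cos_pi]; norm_num
  rw [hlo, hhi, integral_mul_one_sub_rpow (by linarith)]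
  have hd := Real.Gamma_mul_Gamma_add_half ((α + 1) / 2)
  rw [show (α + 1) / 2 + 1 / 2 = α / 2 + 1 by ring, show 2 * ((α + 1) / 2) = α + 1 by ring,
    show 1 - (α + 1) = -α by ring, Real.rpow_neg (by norm_num)] at hd
  have g1 : 0 < Real.Gamma (α / 2 + 1) := Real.Gamma_pos_of_pos (by linarith)
  have g2 : 0 < Real.Gamma (α + 1) := Real.Gamma_pos_of_pos (by linarith)
  have h4 : (4 : ℝ) ^ α = (2 ^ α) ^ 2 := by
    rw [pow_two, ← Real.mul_rpow (by norm_num) (by norm_num)]; norm_num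
  have h2 : (0 : ℝ) < 2 ^ α := by positivity
  have hpi : √Real.pi ^ 2 = Real.pi := Real.sq_sqrt Real.pi_pos.le
  have hd2 : Real.Gamma ((α + 1) / 2) * Real.Gamma (α / 2 + 1) * 2 ^ α =
      Real.Gamma (α + 1) * √Real.pi := by
    rw [hd]; field_simp
  rw [show 2 * ((α + 1) / 2) = α + 1 by ring, h4]
  generalize Real.Gamma (α / 2 + 1) = G at *
  field_simp
  calc (2 ^ α) ^ 2 * Real.Gamma ((α + 1) / 2) ^ 2 * G ^ 2
      = (Real.Gamma ((α + 1) / 2) * G * 2 ^ α) ^ 2 := by ring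
    _ = Real.Gamma (α + 1) ^ 2 * Real.pi := by rw [hd2, mul_pow, hpi]

/-- The Fourier integrals of `(2 sin (θ / 2)) ^ α` over a period. -/
def sinPowIntegral (α : ℝ) (k : ℤ) : ℂ :=
  ∫ θ in (0 : ℝ)..2 * Real.pi, (((2 * Real.sin (θ / 2)) ^ α : ℝ) : ℂ) *
    Complex.exp (k * θ * Complex.I)

lemma continuous_two_mul_sin_half_rpow {α : ℝ} (hα : 0 ≤ α) :
    Continuous fun θ : ℝ => (2 * Real.sin (θ / 2)) ^ α :=
  Continuous.rpow_const (by fun_prop) fun _ => Or.inr hα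

lemma sinPowIntegral_rec {α : ℝ} (hα : 1 < α) (k : ℤ) :
    (α / 2 + k + 1) * sinPowIntegral α (k + 1) = (k - α / 2) * sinPowIntegral α k := by
  have hc := Complex.continuous_ofReal.comp (continuous_two_mul_sin_half_rpow (by linarith : 0 ≤ α))
  have hi : ∀ j : ℤ, IntervalIntegrable (fun θ : ℝ => (((2 * Real.sin (θ / 2)) ^ α : ℝ) : ℂ) *
    Complex.exp (j * θ * Complex.I)) volume 0 (2 * Real.pi) := fun j =>
      (hc.mul (by fun_prop : Continuous fun θ : ℝ => Complex.exp (j * θ * Complex.I))).intervalIntegrable _ _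
  -- `F` vanishes at both endpoints, so its derivative integrates to 0. The half-integer frequency
  -- makes that derivative a combination of the integrands for k and k + 1.
  set F : ℝ → ℂ := fun θ => (((2 * Real.sin (θ / 2)) ^ (α + 1) : ℝ) : ℂ) *
    Complex.exp ((k + 1 / 2) * θ * Complex.I) with hF
  set F' : ℝ → ℂ := fun θ => (α / 2 + k + 1) * ((((2 * Real.sin (θ / 2)) ^ α : ℝ) : ℂ) *
    Complex.exp ((k + 1 : ℤ) * θ * Complex.I)) - (k - α / 2) *
    ((((2 * Real.sin (θ / 2)) ^ α : ℝ) : ℂ) * Complex.exp (k * θ * Complex.I)) with hF'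
  have hd : ∀ θ ∈ Set.uIcc 0 (2 * Real.pi), HasDerivAt F (F' θ) θ := by
    intro θ hθ
    have h1 : HasDerivAt (fun θ : ℝ => θ / 2) (1 / 2) θ := (hasDerivAt_id θ).div_const 2
    have h2 := (((Real.hasDerivAt_sin (θ / 2)).comp θ h1).const_mul 2).rpow_const (p := α + 1)
      (Or.inr (by linarith))
    have h3 : HasDerivAt (fun θ : ℝ => Complex.exp ((k + 1 / 2) * θ * Complex.I))
        (Complex.exp ((k + 1 / 2) * θ * Complex.I) * ((k + 1 / 2) * 1 * Complex.I)) θ :=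
      (((Complex.ofRealCLM.hasDerivAt (x := θ)).const_mul ((k : ℂ) + 1 / 2)).mul_const
        Complex.I).cexp
    have h4 := h2.ofReal_comp.mul h3
    convert! h4 using 1
    have hs := sin_half_nonneg hθ
    simp only [Function.comp_apply]
    rw [add_sub_cancel_right, Real.rpow_add_one' (by positivity) (by linarith)]
    set z := Complex.exp (θ / 2 * Complex.I) with hz
    have hz0 : z ≠ 0 := Complex.exp_ne_zero _
    have ek : Complex.exp ((k + 1 / 2) * θ * Complex.I) = Complex.exp (k * θ * Complex.I) * z := by
      rw [hz, ← Complex.exp_add]; congr 1; ring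
    have ek1 : Complex.exp ((k + 1 : ℤ) * θ * Complex.I) =
        Complex.exp (k * θ * Complex.I) * z * z := by
      rw [hz, ← Complex.exp_add, ← Complex.exp_add]; congr 1; push_cast; ring
    have esin : ((Real.sin (θ / 2) : ℝ) : ℂ) = (z⁻¹ - z) * Complex.I / 2 := by
      rw [Complex.ofReal_sin, Complex.sin, hz, neg_mul, Complex.exp_neg]; push_cast; rfl
    have ecos : ((Real.cos (θ / 2) : ℝ) : ℂ) = (z + z⁻¹) / 2 := by
      rw [Complex.ofReal_cos, Complex.cos, hz, neg_mul, Complex.exp_neg]; push_cast; rfl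
    rw [hF']
    simp only
    rw [ek, ek1]
    push_cast
    simp only [← Complex.ofReal_ofNat, ← Complex.ofReal_div, ← Complex.ofReal_sin,
      ← Complex.ofReal_cos] at *
    rw [esin, ecos]
    push_cast
    field_simp
    linear_combination (-2 * (((2 * Real.sin (θ / 2)) ^ α : ℝ) : ℂ) *
      (k + 1 / 2) * (1 - z ^ 2)) * Complex.I_sq
  have hint := intervalIntegral.integral_eq_sub_of_hasDerivAt hd
    (((hi (k + 1)).const_mul _).sub ((hi k).const_mul _))
  have hF0 : F 0 = 0 := by
    rw [hF]; simp [Real.zero_rpow (by linarith : α + 1 ≠ 0)]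
  have hFp : F (2 * Real.pi) = 0 := by
    rw [hF]; simp [Real.zero_rpow (by linarith : α + 1 ≠ 0)]
  rw [hF0, hFp, hF', intervalIntegral.integral_sub ((hi (k + 1)).const_mul _) ((hi k).const_mul _),
    intervalIntegral.integral_const_mul, intervalIntegral.integral_const_mul, sub_zero,
    sub_eq_zero] at hint
  exact hint

lemma half_ne_intCast {α : ℝ} (hα1 : 1 < α) (hα2 : α < 2) (k : ℤ) : α / 2 ≠ k := by
  intro h
  have h1 : (0 : ℝ) < k := by rw [← h]; linarith
  have h2 : (k : ℝ) < 1 := by rw [← h]; linarith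
  have h1' : 0 < k := by exact_mod_cast h1
  have h2' : k < 1 := by exact_mod_cast h2
  omega

lemma gCoeff_rec {α : ℝ} (hα1 : 1 < α) (hα2 : α < 2) (k : ℤ) :
    (α / 2 + k + 1) * gCoeff α (k + 1) = (k - α / 2) * gCoeff α k := by
  have h1 : α / 2 - k ≠ 0 := sub_ne_zero.2 (half_ne_intCast hα1 hα2 k)
  have h2 : α / 2 + k + 1 ≠ 0 := by
    have := half_ne_intCast hα1 hα2 (-k - 1)
    intro h
    apply this
    push_cast
    linarith
  have e1 : α / 2 - ((k + 1 : ℤ) : ℝ) + 1 = α / 2 - k := by push_cast; ring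
  have e2 : α / 2 + ((k + 1 : ℤ) : ℝ) + 1 = α / 2 + k + 1 + 1 := by push_cast; ring
  rw [gCoeff, gCoeff, e1, e2, Real.Gamma_add_one h1, Real.Gamma_add_one h2,
    zpow_add₀ (by norm_num), zpow_one]
  have e3 : (k : ℝ) - α / 2 = -(α / 2 - k) := by ring
  rw [e3]
  generalize Real.Gamma (α / 2 - k) = G₁
  generalize Real.Gamma (α / 2 + k + 1) = G₂
  generalize α / 2 + k + 1 = p at *
  generalize α / 2 - k = q at *
  simp only [div_eq_mul_inv, mul_inv]
  linear_combination ((-1 : ℝ) ^ k * Real.Gamma (α + 1) * G₁⁻¹ * G₂⁻¹) *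
    (mul_inv_cancel₀ h1 - mul_inv_cancel₀ h2)

/-- Both sides obey the same first-order recursion and agree at k = 0. As α/2 is not an integer, the
recursion's factors never vanish, so it runs in both directions. -/
lemma sinPowIntegral_eq {α : ℝ} (hα1 : 1 < α) (hα2 : α < 2) (k : ℤ) :
    sinPowIntegral α k = 2 * Real.pi * gCoeff α k := by
  have hne1 : ∀ j : ℤ, ((α : ℂ) / 2 + j + 1) ≠ 0 := fun j h => by
    have h' : ((α / 2 + j + 1 : ℝ) : ℂ) = 0 := by push_cast; exact h
    rw [Complex.ofReal_eq_zero] at h'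
    exact half_ne_intCast hα1 hα2 (-j - 1) (by push_cast; linarith)
  have hne2 : ∀ j : ℤ, ((j : ℂ) - α / 2) ≠ 0 := fun j h => by
    have h' : ((j - α / 2 : ℝ) : ℂ) = 0 := by push_cast; exact h
    rw [Complex.ofReal_eq_zero] at h'
    exact half_ne_intCast hα1 hα2 j (by linarith)
  have hg : ∀ j : ℤ, ((α : ℂ) / 2 + j + 1) * gCoeff α (j + 1) = (j - α / 2) * gCoeff α j :=
    fun j => by exact_mod_cast congrArg ((↑) : ℝ → ℂ) (gCoeff_rec hα1 hα2 j)
  induction k using Int.induction_on with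
  | zero =>
    have h := integral_two_mul_sin_half_rpow hα1
    rw [sinPowIntegral]
    simp only [Int.cast_zero, zero_mul, Complex.exp_zero, mul_one]
    rw [intervalIntegral.integral_ofReal, h, gCoeff]
    push_cast
    simp [pow_two]
  | succ i ih =>
    refine mul_left_cancel₀ (hne1 i) ?_
    rw [sinPowIntegral_rec hα1, ih]
    linear_combination (-2 * Real.pi : ℂ) * hg i
  | pred i ih =>
    refine mul_left_cancel₀ (hne2 (-i - 1)) ?_
    have h1 := sinPowIntegral_rec hα1 (-i - 1)
    have h2 := hg (-i - 1)
    rw [sub_add_cancel] at h1 h2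
    rw [← h1, ih]
    linear_combination (2 * Real.pi : ℂ) * h2

lemma gCoeff_neg (α : ℝ) (k : ℤ) : gCoeff α (-k) = gCoeff α k := by
  rw [gCoeff, gCoeff, zpow_neg, ← inv_zpow]
  push_cast
  rw [show ((-1 : ℝ))⁻¹ = -1 by norm_num, sub_neg_eq_add, ← sub_eq_add_neg, mul_comm (Real.Gamma (α / 2 + k + 1))]

/-- For k ≥ 1 the recursion, taken in absolute value, gives α|g_k| = (α/2 + k)|g_k| - (α/2 + k +
1)|g_{k+1}|. The partial sums telescope and stay bounded. Starting at k = 1 keeps k - α/2 positive.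
-/
lemma summable_gCoeff {α : ℝ} (hα1 : 1 < α) (hα2 : α < 2) : Summable (gCoeff α) := by
  have hnat : Summable fun n : ℕ => |gCoeff α ((n + 1 : ℕ) : ℤ)| := by
    have hrec : ∀ n : ℕ, (α / 2 + n + 2) * |gCoeff α ((n + 1 + 1 : ℕ) : ℤ)| =
        (n + 1 - α / 2) * |gCoeff α ((n + 1 : ℕ) : ℤ)| := fun n => by
      have h := congrArg abs (gCoeff_rec hα1 hα2 ((n + 1 : ℕ) : ℤ))
      rw [abs_mul, abs_mul] at h
      push_cast at h ⊢
      have hn : (0 : ℝ) ≤ n := by positivity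
      rw [abs_of_nonneg (by linarith : (0 : ℝ) ≤ α / 2 + (n + 1) + 1),
        abs_of_nonneg (by linarith : (0 : ℝ) ≤ n + 1 - α / 2)] at h
      linear_combination h
    have hsum : ∀ n : ℕ, α * ∑ i ∈ Finset.range n, |gCoeff α ((i + 1 : ℕ) : ℤ)| =
        (α / 2 + 1) * |gCoeff α ((0 + 1 : ℕ) : ℤ)| -
          (α / 2 + n + 1) * |gCoeff α ((n + 1 : ℕ) : ℤ)| := fun n => by
      induction n with
      | zero => simp
      | succ n ih =>
        rw [Finset.sum_range_succ, mul_add, ih]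
        have := hrec n
        push_cast at this ⊢
        linear_combination this
    refine summable_of_sum_range_le (c := (α / 2 + 1) * |gCoeff α ((0 + 1 : ℕ) : ℤ)|)
      (fun n => abs_nonneg _) fun n => ?_
    have h1 := hsum n
    have h2 : 0 ≤ ∑ i ∈ Finset.range n, |gCoeff α ((i + 1 : ℕ) : ℤ)| :=
      Finset.sum_nonneg fun i _ => abs_nonneg _
    have h3 : 0 ≤ (α / 2 + n + 1) * |gCoeff α ((n + 1 : ℕ) : ℤ)| := by positivity
    nlinarith
  have h1 : Summable fun n : ℕ => gCoeff α ((n + 1 : ℕ) : ℤ) := hnat.of_abs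
  have h2 : Summable fun n : ℕ => gCoeff α (n : ℤ) := (summable_nat_add_iff 1).1 h1
  exact Summable.of_nat_of_neg h2 (by simpa only [gCoeff_neg] using h2)

lemma hasSum_gCoeff_mul_exp {α : ℝ} (hα1 : 1 < α) (hα2 : α < 2) (θ : ℝ) :
    HasSum (fun k : ℤ => (gCoeff α k : ℂ) * Complex.exp (-(k * θ * Complex.I)))
      ((|2 * Real.sin (θ / 2)| ^ α : ℝ) : ℂ) := by
  have : Fact (0 < 2 * Real.pi) := ⟨Real.two_pi_pos⟩
  set f : ℝ → ℂ := fun θ => ((|2 * Real.sin (θ / 2)| ^ α : ℝ) : ℂ) with hf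
  have hper : Function.Periodic f (2 * Real.pi) := fun θ => by
    simp only [hf]
    rw [show (θ + 2 * Real.pi) / 2 = θ / 2 + Real.pi by ring, Real.sin_add_pi, mul_neg, abs_neg]
  have hcont : Continuous f :=
    Complex.continuous_ofReal.comp (Continuous.rpow_const (by fun_prop) fun _ => Or.inr (by linarith))
  let Φ : C(AddCircle (2 * Real.pi), ℂ) := ⟨hper.lift, continuous_coinduced_dom.mpr hcont⟩
  have hcoef : ∀ k : ℤ, fourierCoeff Φ k = gCoeff α k := fun k => by
    rw [fourierCoeff_eq_intervalIntegral Φ k 0, zero_add]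
    have e : ∫ x in (0 : ℝ)..2 * Real.pi, (fourier (-k)) (x : AddCircle (2 * Real.pi)) •
        Φ (x : AddCircle (2 * Real.pi)) = sinPowIntegral α (-k) := by
      refine intervalIntegral.integral_congr fun x hx => ?_
      have hs := sin_half_nonneg hx
      rw [fourier_coe_apply, smul_eq_mul, mul_comm]
      change f x * _ = _
      simp only [hf]
      rw [abs_of_nonneg (by positivity)]
      congr 2
      push_cast
      field_simp
    rw [e, sinPowIntegral_eq hα1 hα2, gCoeff_neg, Complex.real_smul]
    push_cast
    field_simp
  have hs : Summable (fourierCoeff Φ) := by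
    rw [funext hcoef]
    exact Complex.ofRealCLM.summable (summable_gCoeff hα1 hα2)
  -- Evaluation at -θ produces the factors exp(-ikθ) that come from the shifts x - kh; the function
  -- itself is even.
  have h := has_pointwise_sum_fourier_series_of_summable hs ((-θ : ℝ) : AddCircle (2 * Real.pi))
  have hval : Φ ((-θ : ℝ) : AddCircle (2 * Real.pi)) = ((|2 * Real.sin (θ / 2)| ^ α : ℝ) : ℂ) := by
    change f (-θ) = _
    simp only [hf]
    rw [neg_div, Real.sin_neg, mul_neg, abs_neg]
  rw [hval] at h
  convert! h using 2 with k
  rw [hcoef, fourier_coe_apply, smul_eq_mul]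
  congr 2
  push_cast
  field_simp

lemma summable_gCoeff_mul {α : ℝ} (hα1 : 1 < α) (hα2 : α < 2) {u : ℝ → ℝ} (hu : u ∈ boundedFun)
    (h x : ℝ) : Summable fun k : ℤ => gCoeff α k * u (x - k * h) := by
  obtain ⟨M, hM⟩ := hu
  refine Summable.of_norm_bounded ((summable_gCoeff hα1 hα2).abs.mul_right M) fun k => ?_
  rw [norm_mul, Real.norm_eq_abs, Real.norm_eq_abs]
  gcongr
  exact hM _

lemma IsFourierInt.fracDiff {α : ℝ} (hα1 : 1 < α) (hα2 : α < 2) {φ : ℝ → ℂ} {u : ℝ → ℝ}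
    (hu : IsFourierInt φ u) (h : ℝ) :
    IsFourierInt (fun ω => ((|2 * Real.sin (Real.pi * ω * h)| ^ α : ℝ) : ℂ) * φ ω)
      (fracDiff α h u) := by
  constructor
  · refine hu.1.bdd_mul (c := 2 ^ α) (Continuous.aestronglyMeasurable ?_) ?_
    · exact Complex.continuous_ofReal.comp
        (Continuous.rpow_const (by fun_prop) fun _ => Or.inr (by linarith))
    · refine Eventually.of_forall fun ω => ?_
      rw [Complex.norm_real, Real.norm_eq_abs, abs_of_nonneg (by positivity)]
      refine Real.rpow_le_rpow (abs_nonneg _) ?_ (by linarith)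
      rw [abs_mul, abs_two]
      linarith [Real.abs_sin_le_one (Real.pi * ω * h)]
  · intro x
    set F : ℤ → ℝ → ℂ := fun k ω => (gCoeff α k : ℂ) *
      (Complex.exp ((2 * Real.pi * ω * (x - k * h) : ℝ) * Complex.I) * φ ω) with hF
    have hFi : ∀ k, Integrable (F k) := fun k => (integrable_exp_mul hu.1 _).const_mul _
    have hFn : Summable fun k => ∫ ω, ‖F k ω‖ := by
      have : ∀ k, ∫ ω, ‖F k ω‖ = |gCoeff α k| * ∫ ω, ‖φ ω‖ := fun k => by
        simp only [hF, norm_mul, Complex.norm_exp_ofReal_mul_I, one_mul, Complex.norm_real,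
          Real.norm_eq_abs]
        rw [integral_const_mul]
      simp only [this]
      exact (summable_gCoeff hα1 hα2).abs.mul_right _
    have hs := hasSum_integral_of_summable_integral_norm hFi hFn
    have e1 : ∀ k, ∫ ω, F k ω = ((gCoeff α k * u (x - k * h) : ℝ) : ℂ) := fun k => by
      simp only [hF]
      rw [integral_const_mul, ← hu.2]
      push_cast; rfl
    have e2 : ∀ ω, ∑' k, F k ω = Complex.exp ((2 * Real.pi * ω * x : ℝ) * Complex.I) *
        (((|2 * Real.sin (Real.pi * ω * h)| ^ α : ℝ) : ℂ) * φ ω) := fun ω => by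
      have h1 := (hasSum_gCoeff_mul_exp hα1 hα2 (2 * Real.pi * ω * h)).mul_left
        (Complex.exp ((2 * Real.pi * ω * x : ℝ) * Complex.I) * φ ω)
      rw [show 2 * Real.pi * ω * h / 2 = Real.pi * ω * h by ring] at h1
      rw [← mul_assoc, mul_right_comm, ← h1.tsum_eq]
      refine tsum_congr fun k => ?_
      have e : Complex.exp ((2 * Real.pi * ω * (x - k * h) : ℝ) * Complex.I) =
          Complex.exp ((2 * Real.pi * ω * x : ℝ) * Complex.I) *
            Complex.exp (-(k * (2 * Real.pi * ω * h : ℝ) * Complex.I)) := by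
        rw [← Complex.exp_add]
        congr 1
        push_cast
        ring
      simp only [hF, e]
      ring
    simp only [e1, e2] at hs
    rw [← hs.tsum_eq, ← Complex.ofReal_tsum]
    rfl

end RieszCompact

/-! ### Fourier representation of the Riesz potential and of the Riesz derivative. -/

namespace RieszCompact

open MeasureTheory Filter FourierTransform Set

lemma one_div_pi_mul_sq_rpow {y : ℝ} (hy : y ≠ 0) (p : ℝ) :
    (1 / (Real.pi * y ^ 2)) ^ p = Real.pi ^ (-p) * |y| ^ (-(2 * p)) := by
  have hy' : 0 < |y| := abs_pos.2 hy
  rw [one_div, Real.inv_rpow (by positivity), ← Real.rpow_neg (by positivity), ← sq_abs,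
    Real.mul_rpow Real.pi_pos.le (by positivity), ← Real.rpow_two, ← Real.rpow_mul hy'.le]
  congr 2
  ring

lemma integrableOn_rpow_mul_exp_neg {p r : ℝ} (hp : 0 < p) (hr : 0 < r) :
    IntegrableOn (fun b : ℝ => b ^ (p - 1) * Real.exp (-(r * b))) (Ioi 0) := by
  have := integrableOn_rpow_mul_exp_neg_mul_rpow (s := p - 1) (p := 1) (by linarith) one_pos hr
  simpa using this

/-- The change of variables b ↦ 1/b, which turns the Gamma integral in exp(-rb) into one in
exp(-r/b). -/
lemma rpow_inv_comp_eq {q r x : ℝ} (hx : 0 < x) :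
    (|(-1 : ℝ)| * x ^ ((-1 : ℝ) - 1)) • ((x ^ (-1 : ℝ)) ^ (q - 1) *
      Real.exp (-(r * x ^ (-1 : ℝ)))) = x ^ (-q - 1) * Real.exp (-(r / x)) := by
  rw [abs_neg, abs_one, one_mul, smul_eq_mul, ← Real.rpow_mul hx.le, ← mul_assoc,
    ← Real.rpow_add hx, Real.rpow_neg_one, div_eq_mul_inv]
  congr 2
  ring

lemma integrableOn_rpow_mul_exp_neg_div {q r : ℝ} (hq : 0 < q) (hr : 0 < r) :
    IntegrableOn (fun b : ℝ => b ^ (-q - 1) * Real.exp (-(r / b))) (Ioi 0) := by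
  have h := (integrableOn_Ioi_comp_rpow_iff _ (by norm_num : (-1 : ℝ) ≠ 0)).2
    (integrableOn_rpow_mul_exp_neg hq hr)
  exact h.congr_fun (fun x hx => rpow_inv_comp_eq hx) measurableSet_Ioi

lemma integral_rpow_mul_exp_neg_div {q r : ℝ} (hq : 0 < q) (hr : 0 < r) :
    ∫ b in Ioi (0 : ℝ), b ^ (-q - 1) * Real.exp (-(r / b)) = (1 / r) ^ q * Real.Gamma q := by
  rw [← Real.integral_rpow_mul_exp_neg_mul_Ioi hq hr,
    ← integral_comp_rpow_Ioi (fun b => b ^ (q - 1) * Real.exp (-(r * b)))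
      (by norm_num : (-1 : ℝ) ≠ 0)]
  exact setIntegral_congr_fun measurableSet_Ioi fun x hx => (rpow_inv_comp_eq hx).symm

/-- Fubini for a positive kernel whose integral over the parameter is a power. -/
lemma integral_integral_kernel {k : ℝ → ℝ → ℝ} (hk : Measurable (Function.uncurry k))
    (hk0 : ∀ y b, 0 < b → 0 ≤ k y b) (hi : ∀ y, y ≠ 0 → IntegrableOn (k y) (Ioi 0)) {c r : ℝ}
    (hv : ∀ y, y ≠ 0 → ∫ b in Ioi 0, k y b = c * |y| ^ r) {f : ℝ → ℂ}
    (hf : AEStronglyMeasurable f) (hfi : Integrable fun y => ((|y| ^ r : ℝ) : ℂ) * f y) :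
    ∫ b in Ioi (0 : ℝ), ∫ y, (k y b : ℂ) * f y = c * ∫ y, ((|y| ^ r : ℝ) : ℂ) * f y := by
  have hne : ∀ᵐ y : ℝ, y ≠ 0 := by
    simp [ae_iff, measure_singleton]
  have hnorm : ∀ y, y ≠ 0 → ∫ b in Ioi 0, ‖(k y b : ℂ) * f y‖ = c * ‖((|y| ^ r : ℝ) : ℂ) * f y‖ := by
    intro y hy
    simp only [norm_mul, Complex.norm_real, Real.norm_eq_abs]
    rw [integral_mul_const, abs_of_nonneg (by positivity : 0 ≤ |y| ^ r), ← mul_assoc, ← hv y hy]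
    congr 1
    exact setIntegral_congr_fun measurableSet_Ioi fun b hb => abs_of_nonneg (hk0 y b hb)
  have hI : Integrable (Function.uncurry fun y b => (k y b : ℂ) * f y)
      (volume.prod (volume.restrict (Ioi 0))) := by
    refine (integrable_prod_iff ?_).2 ⟨?_, ?_⟩
    · exact (Complex.measurable_ofReal.comp hk).aestronglyMeasurable.mul hf.comp_fst
    · filter_upwards [hne] with y hy
      exact (Integrable.ofReal (𝕜 := ℂ) (hi y hy)).mul_const (f y)
    · refine (hfi.norm.const_mul c).congr ?_
      filter_upwards [hne] with y hy
      exact (hnorm y hy).symm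
  rw [← integral_integral_swap hI, ← integral_const_mul]
  refine integral_congr_ae ?_
  filter_upwards [hne] with y hy
  rw [integral_mul_const, integral_complex_ofReal, hv y hy]
  push_cast
  ring

lemma integral_exp_mul_gaussian {b : ℝ} (hb : 0 < b) (ω : ℝ) :
    ∫ y : ℝ, Complex.exp (-((2 * Real.pi * ω * y : ℝ) * Complex.I)) *
      ((Real.exp (-(Real.pi * y ^ 2 * b)) : ℝ) : ℂ) =
      ((b ^ (-(1 / 2) : ℝ) * Real.exp (-(Real.pi * ω ^ 2 / b)) : ℝ) : ℂ) := by
  have h := congrFun (fourier_gaussian_pi (b := b) (by simpa)) ω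
  rw [Real.fourier_eq'] at h
  convert! h using 1
  · refine integral_congr_ae (Eventually.of_forall fun y => ?_)
    simp only [smul_eq_mul, RCLike.inner_apply, conj_trivial]
    push_cast
    congr 2 <;> ring
  · have e : ((b ^ (-(1 / 2) : ℝ) : ℝ) : ℂ) = 1 / (b : ℂ) ^ (1 / 2 : ℂ) := by
      rw [Complex.ofReal_cpow hb.le, one_div ((b : ℂ) ^ (1 / 2 : ℂ)), ← Complex.cpow_neg]
      push_cast
      rfl
    rw [Complex.ofReal_mul, e]
    push_cast
    congr 2
    ring

lemma IsFourierInt.integral_gaussian {φ : ℝ → ℂ} {u : ℝ → ℝ} (hu : IsFourierInt φ u) (x : ℝ)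
    {b : ℝ} (hb : 0 < b) :
    ∫ y : ℝ, ((Real.exp (-(Real.pi * y ^ 2 * b)) : ℝ) : ℂ) * (u (x - y) : ℂ) =
      ∫ ω : ℝ, ((b ^ (-(1 / 2) : ℝ) * Real.exp (-(Real.pi * ω ^ 2 / b)) : ℝ) : ℂ) *
        (Complex.exp ((2 * Real.pi * ω * x : ℝ) * Complex.I) * φ ω) := by
  set g : ℝ → ℂ := fun y => ((Real.exp (-(Real.pi * y ^ 2 * b)) : ℝ) : ℂ) with hg
  have hgi : Integrable g := by
    have := (integrable_exp_neg_mul_sq (b := Real.pi * b) (by positivity)).ofReal (𝕜 := ℂ)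
    refine this.congr (Eventually.of_forall fun y => ?_)
    simp only [hg]
    congr 3
    ring
  set F : ℝ → ℝ → ℂ := fun y ω => Complex.exp ((2 * Real.pi * ω * (x - y) : ℝ) * Complex.I) *
    (g y * φ ω) with hF
  have hI : Integrable (Function.uncurry F) (volume.prod volume) := by
    refine (hgi.mul_prod hu.1).bdd_mul (c := 1) (Continuous.aestronglyMeasurable (by fun_prop)) ?_
    exact Eventually.of_forall fun z => (Complex.norm_exp_ofReal_mul_I _).le
  calc ∫ y : ℝ, g y * (u (x - y) : ℂ) = ∫ y, ∫ ω, F y ω := by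
        refine integral_congr_ae (Eventually.of_forall fun y => ?_)
        simp only [hF]
        rw [hu.2, ← integral_const_mul]
        refine integral_congr_ae (Eventually.of_forall fun ω => ?_)
        simp only
        ring
    _ = ∫ ω, ∫ y, F y ω := integral_integral_swap hI
    _ = _ := by
        refine integral_congr_ae (Eventually.of_forall fun ω => ?_)
        simp only
        rw [← integral_exp_mul_gaussian hb, ← integral_mul_const]
        refine integral_congr_ae (Eventually.of_forall fun y => ?_)
        have e : Complex.exp ((2 * Real.pi * ω * (x - y) : ℝ) * Complex.I) =
            Complex.exp (-((2 * Real.pi * ω * y : ℝ) * Complex.I)) *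
              Complex.exp ((2 * Real.pi * ω * x : ℝ) * Complex.I) := by
          rw [← Complex.exp_add]
          congr 1
          push_cast
          ring
        simp only [hF, e, hg]
        ring

/-- The Fourier representation of the Riesz potential. -/
lemma IsFourierInt.riesz_potential {φ : ℝ → ℂ} {u : ℝ → ℝ} (hu : IsFourierInt φ u) {s : ℝ}
    (hs0 : 0 < s) (hs1 : s < 1) (x : ℝ)
    (h1 : Integrable fun y => ((|y| ^ (-s) : ℝ) : ℂ) * (u (x - y) : ℂ))
    (hum : AEStronglyMeasurable fun y => (u (x - y) : ℂ))
    (h2 : Integrable fun ω => ((|ω| ^ (s - 1) : ℝ) : ℂ) * φ ω) :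
    ((Real.pi ^ (-(s / 2)) * Real.Gamma (s / 2) : ℝ) : ℂ) *
      ∫ y, ((|y| ^ (-s) : ℝ) : ℂ) * (u (x - y) : ℂ) =
    ((Real.pi ^ (-((1 - s) / 2)) * Real.Gamma ((1 - s) / 2) : ℝ) : ℂ) *
      ∫ ω : ℝ, Complex.exp ((2 * Real.pi * ω * x : ℝ) * Complex.I) *
        (((|ω| ^ (s - 1) : ℝ) : ℂ) * φ ω) := by
  have hq : 0 < (1 - s) / 2 := by linarith
  -- Up to a constant, |y|^(-s) is the integral of b^(s/2-1) exp(-πy²b) over b > 0. Likewise `B`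
  -- writes |ω|^(s-1) through exp(-πω²/b). The Gaussian transform at fixed b links the two; its
  -- factor b^(-1/2) accounts for the change of exponent.
  have A := integral_integral_kernel
    (k := fun y b => b ^ (s / 2 - 1) * Real.exp (-(Real.pi * y ^ 2 * b)))
    (by fun_prop) (fun y b hb => by positivity)
    (fun y hy => integrableOn_rpow_mul_exp_neg (by positivity) (by positivity))
    (c := Real.pi ^ (-(s / 2)) * Real.Gamma (s / 2)) (r := -s)
    (fun y hy => by
      rw [Real.integral_rpow_mul_exp_neg_mul_Ioi (by positivity) (by positivity),
        one_div_pi_mul_sq_rpow hy, mul_div_cancel₀ s two_ne_zero]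
      ring) hum h1
  have h2' : Integrable fun ω : ℝ => ((|ω| ^ (s - 1) : ℝ) : ℂ) *
      (Complex.exp ((2 * Real.pi * ω * x : ℝ) * Complex.I) * φ ω) := by
    simpa only [mul_left_comm] using integrable_exp_mul h2 x
  have B := integral_integral_kernel
    (k := fun ω b => b ^ (-((1 - s) / 2) - 1) * Real.exp (-(Real.pi * ω ^ 2 / b)))
    (by fun_prop) (fun y b hb => by positivity)
    (fun y hy => integrableOn_rpow_mul_exp_neg_div hq (by positivity))
    (c := Real.pi ^ (-((1 - s) / 2)) * Real.Gamma ((1 - s) / 2)) (r := s - 1)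
    (fun y hy => by
      rw [integral_rpow_mul_exp_neg_div hq (by positivity), one_div_pi_mul_sq_rpow hy,
        show -(2 * ((1 - s) / 2)) = s - 1 by ring]
      ring) (integrable_exp_mul hu.1 x).1 h2'
  simp only [mul_left_comm (Complex.exp _)]
  rw [← A, ← B]
  refine setIntegral_congr_fun measurableSet_Ioi fun b hb => ?_
  have hb' : (0 : ℝ) < b := hb
  have h := hu.integral_gaussian x hb'
  have e : ∀ y : ℝ, ((b ^ (s / 2 - 1) * Real.exp (-(Real.pi * y ^ 2 * b)) : ℝ) : ℂ) *
      (u (x - y) : ℂ) = ((b ^ (s / 2 - 1) : ℝ) : ℂ) *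
        (((Real.exp (-(Real.pi * y ^ 2 * b)) : ℝ) : ℂ) * (u (x - y) : ℂ)) := fun y => by
    rw [Complex.ofReal_mul, mul_assoc]
  simp only [e]
  rw [integral_const_mul, h, ← integral_const_mul]
  refine integral_congr_ae (Eventually.of_forall fun ω => ?_)
  simp only
  rw [← mul_assoc, ← Complex.ofReal_mul, ← mul_assoc (b ^ (s / 2 - 1)), ← Real.rpow_add hb',
    show s / 2 - 1 + -(1 / 2) = -((1 - s) / 2) - 1 by ring]

lemma IsFourierInt.iteratedDeriv_two {φ : ℝ → ℂ} {v : ℝ → ℝ} (hv : IsFourierInt φ v)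
    (hφ : ∀ j ≤ 2, Integrable fun ω : ℝ => ((|ω| ^ j : ℝ) : ℂ) * φ ω) :
    ContDiff ℝ 2 v ∧
      IsFourierInt (fun ω => ((-(2 * Real.pi * ω) ^ 2 : ℝ) : ℂ) * φ ω) (iteratedDeriv 2 v) := by
  -- Reflection turns the inverse Fourier integral into a forward transform, for which
  -- differentiation under the integral is available.
  set g : ℝ → ℂ := fun ω => φ (-ω) with hg
  have hgm : AEStronglyMeasurable g := hv.1.comp_neg.1
  have hn : ∀ j ≤ 2, Integrable fun ω : ℝ => ‖ω‖ ^ j * ‖g ω‖ := fun j hj => by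
    have := ((hφ j hj).comp_neg).norm
    simpa [hg, norm_mul] using this
  have hs : ∀ j ≤ 2, Integrable fun ω : ℝ => ω ^ j • g ω := fun j hj => by
    refine (hn j hj).mono 
      ((Measurable.aestronglyMeasurable (f := fun ω : ℝ => ω ^ j) (by fun_prop)).smul hgm) ?_
    exact Eventually.of_forall fun ω => by simp
  have hF : ∀ (ψ : ℝ → ℂ) (x : ℝ), 𝓕 (fun ω => ψ (-ω)) x =
      ∫ ω : ℝ, Complex.exp ((2 * Real.pi * ω * x : ℝ) * Complex.I) * ψ ω := fun ψ x => by
    rw [Real.fourier_eq', ← integral_neg_eq_self]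
    refine integral_congr_ae (Eventually.of_forall fun ω => ?_)
    simp only [smul_eq_mul, RCLike.inner_apply, conj_trivial, neg_neg]
    congr 3
    push_cast
    ring
  have hvF : (fun x => (v x : ℂ)) = 𝓕 g := by
    ext x
    rw [hv.2, hg, hF]
  have hcd : ContDiff ℝ ((2 : ℕ∞) : WithTop ℕ∞) (𝓕 g) :=
    Real.contDiff_fourier fun j hj => hn j (by exact_mod_cast hj)
  have hc : ContDiff ℝ 2 v := by
    have : ContDiff ℝ 2 fun x => Complex.reCLM (𝓕 g x) :=
      Complex.reCLM.contDiff.comp (by exact_mod_cast hcd)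
    rw [← hvF] at this
    simpa using this
  refine ⟨hc, ?_, fun x => ?_⟩
  · have h := (hφ 2 le_rfl).const_mul (-(2 * Real.pi) ^ 2)
    refine h.congr (Eventually.of_forall fun ω => ?_)
    simp only [sq_abs]
    push_cast
    ring
  · have h1 := congrFun (iteratedDeriv_ofReal_comp (k := 2) (N := 2) (by exact_mod_cast hc) le_rfl) x
    rw [← h1, hvF, Real.iteratedDeriv_fourier (N := 2) (n := 2)
      (fun j hj => hs j (by exact_mod_cast hj)) (by norm_num)]
    rw [← hF fun ω => ((-(2 * Real.pi * ω) ^ 2 : ℝ) : ℂ) * φ ω]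
    refine congrArg (fun f : ℝ → ℂ => 𝓕 f x) (funext fun ω => ?_)
    simp only [hg, smul_eq_mul]
    push_cast
    linear_combination (4 * (Real.pi : ℂ) ^ 2 * ω ^ 2 * φ (-ω)) * Complex.I_sq

/-- Duplication at (2 - α)/2 and reflection at (α - 1)/2 eliminate the Gamma factors. The sine from
reflection is -cos(πα/2), which cancels the cosine in `kappa` and leaves the minus sign. -/
lemma riesz_constant {α : ℝ} (hα1 : 1 < α) (hα2 : α < 2) :
    kappa α / Real.Gamma (2 - α) * ((2 * Real.pi) ^ 2 *
      (Real.pi ^ (-((1 - (α - 1)) / 2)) * Real.Gamma ((1 - (α - 1)) / 2) /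
        (Real.pi ^ (-((α - 1) / 2)) * Real.Gamma ((α - 1) / 2)))) = -(2 * Real.pi) ^ α := by
  have hpi := Real.pi_pos
  have d1 := Real.Gamma_mul_Gamma_add_half ((1 - (α - 1)) / 2)
  rw [show (1 - (α - 1)) / 2 + 1 / 2 = (3 - α) / 2 by ring,
    show 2 * ((1 - (α - 1)) / 2) = 2 - α by ring, show 1 - (2 - α) = α - 1 by ring] at d1
  have d2 := Real.Gamma_mul_Gamma_one_sub ((α - 1) / 2)
  rw [show 1 - (α - 1) / 2 = (3 - α) / 2 by ring,
    show Real.pi * ((α - 1) / 2) = Real.pi * α / 2 - Real.pi / 2 by ring,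
    Real.sin_sub_pi_div_two] at d2
  have hcos : Real.cos (Real.pi * α / 2) < 0 := by
    refine Real.cos_neg_of_pi_div_two_lt_of_lt ?_ ?_ <;> nlinarith
  have g1 : 0 < Real.Gamma (2 - α) := Real.Gamma_pos_of_pos (by linarith)
  have g2 : 0 < Real.Gamma ((3 - α) / 2) := Real.Gamma_pos_of_pos (by linarith)
  have g3 : 0 < Real.Gamma ((α - 1) / 2) := Real.Gamma_pos_of_pos (by linarith)
  have hsq : √Real.pi * √Real.pi = Real.pi := Real.mul_self_sqrt hpi.le
  have hs0 : 0 < √Real.pi := Real.sqrt_pos.2 hpi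
  have e1 : Real.pi ^ (-((1 - (α - 1)) / 2)) =
      Real.pi ^ (-((α - 1) / 2)) * (Real.pi ^ α * √Real.pi / Real.pi ^ 2) := by
    rw [Real.sqrt_eq_rpow, ← Real.rpow_two, ← Real.rpow_add hpi, ← Real.rpow_sub hpi,
      ← Real.rpow_add hpi]
    congr 1
    ring
  have e2 : (2 : ℝ) ^ (α - 1) = 2 ^ α / 2 := by
    rw [Real.rpow_sub_one two_ne_zero]
  rw [kappa, e1, Real.mul_rpow two_pos.le hpi.le]
  rw [e2] at d1
  have hG : Real.Gamma ((1 - (α - 1)) / 2) =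
      Real.Gamma (2 - α) * (2 ^ α / 2) * √Real.pi / Real.Gamma ((3 - α) / 2) := by
    rw [eq_div_iff g2.ne', d1]
  have hG2 : Real.Gamma ((3 - α) / 2) =
      Real.pi / -Real.cos (Real.pi * α / 2) / Real.Gamma ((α - 1) / 2) := by
    rw [eq_div_iff g3.ne', mul_comm, d2]
  rw [hG, hG2]
  generalize Real.cos (Real.pi * α / 2) = c at *
  generalize Real.Gamma (2 - α) = G at *
  generalize Real.Gamma ((α - 1) / 2) = G' at *
  have hp : 0 < Real.pi ^ (-((α - 1) / 2)) := by positivity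
  have hc := hcos.ne
  field_simp
  linear_combination -hsq

end RieszCompact

/-! ### Comparison of symbols and the error estimate. -/

namespace RieszCompact

open MeasureTheory Filter Set

/-- Near 0 the expansion `h0`, multiplied by |θ|^α, gives the bound. For |θ| ≥ δ boundedness of `P`
and `Q` suffices, since (|θ|/δ)^(2n) and (|θ|/δ)^(2n+α) are at least 1. The constant adds up the
three contributions. -/
lemma symbol_bound {α : ℝ} (hα : 0 < α) {n : ℕ} {P Q : ℝ → ℝ} {M L : ℝ}
    (hP : ∀ θ, |P θ| ≤ M) (hQ : ∀ θ, |Q θ| ≤ L)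
    (h0 : ∃ K, 0 ≤ K ∧ ∀ᶠ θ : ℝ in 𝓝[≠] 0,
      |P θ - Q θ * |2 * Real.sin (θ / 2) / θ| ^ α| ≤ K * |θ| ^ (2 * n)) :
    ∃ C, 0 ≤ C ∧ ∀ θ : ℝ, |P θ * |θ| ^ α - Q θ * |2 * Real.sin (θ / 2)| ^ α| ≤
      C * |θ| ^ ((2 * n : ℕ) + α) := by
  obtain ⟨K, hK0, hK⟩ := h0
  rw [eventually_nhdsWithin_iff, Metric.eventually_nhds_iff] at hK
  obtain ⟨δ, hδ, hK⟩ := hK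
  have hM : 0 ≤ M := (abs_nonneg _).trans (hP 0)
  have hL : 0 ≤ L := (abs_nonneg _).trans (hQ 0)
  refine ⟨K + M / δ ^ (2 * n) + L * 2 ^ α / δ ^ ((2 * n : ℕ) + α), by positivity, fun θ => ?_⟩
  rcases eq_or_ne θ 0 with rfl | hθ
  · simp [Real.zero_rpow hα.ne']
    positivity
  have hθ' : 0 < |θ| := abs_pos.2 hθ
  have hsplit : |θ| ^ ((2 * n : ℕ) + α) = |θ| ^ (2 * n) * |θ| ^ α := by
    rw [Real.rpow_add hθ', Real.rpow_natCast]
  have hT : 0 ≤ |θ| ^ ((2 * n : ℕ) + α) := by positivity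
  have t2 : 0 ≤ M / δ ^ (2 * n) * |θ| ^ ((2 * n : ℕ) + α) := by positivity
  have t3 : 0 ≤ L * 2 ^ α / δ ^ ((2 * n : ℕ) + α) * |θ| ^ ((2 * n : ℕ) + α) := by positivity
  rw [add_mul, add_mul]
  rcases lt_or_ge |θ| δ with hlt | hge
  · have h1 := hK (y := θ) (by simpa using hlt) hθ
    have e : |2 * Real.sin (θ / 2)| ^ α = |2 * Real.sin (θ / 2) / θ| ^ α * |θ| ^ α := by
      rw [← Real.mul_rpow (abs_nonneg _) (abs_nonneg _), ← abs_mul, div_mul_cancel₀ _ hθ]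
    have e2 : P θ * |θ| ^ α - Q θ * |2 * Real.sin (θ / 2)| ^ α =
        (P θ - Q θ * |2 * Real.sin (θ / 2) / θ| ^ α) * |θ| ^ α := by rw [e]; ring
    have h2 : |P θ * |θ| ^ α - Q θ * |2 * Real.sin (θ / 2)| ^ α| ≤
        K * |θ| ^ ((2 * n : ℕ) + α) := by
      rw [e2, abs_mul, abs_of_nonneg (by positivity : 0 ≤ |θ| ^ α), hsplit, ← mul_assoc]
      gcongr
    linarith
  · have h1 : |P θ * |θ| ^ α| ≤ M / δ ^ (2 * n) * |θ| ^ ((2 * n : ℕ) + α) := by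
      rw [abs_mul, abs_of_nonneg (by positivity : 0 ≤ |θ| ^ α), hsplit, ← mul_assoc]
      gcongr
      refine (hP θ).trans ?_
      rw [div_mul_eq_mul_div, le_div_iff₀ (by positivity)]
      gcongr
    have h2 : |Q θ * |2 * Real.sin (θ / 2)| ^ α| ≤
        L * 2 ^ α / δ ^ ((2 * n : ℕ) + α) * |θ| ^ ((2 * n : ℕ) + α) := by
      rw [abs_mul, abs_of_nonneg (by positivity : 0 ≤ |2 * Real.sin (θ / 2)| ^ α)]
      have hs : |2 * Real.sin (θ / 2)| ≤ 2 := by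
        rw [abs_mul, abs_two]
        linarith [Real.abs_sin_le_one (θ / 2)]
      calc |Q θ| * |2 * Real.sin (θ / 2)| ^ α ≤ L * 2 ^ α := by
            gcongr
            exact hQ θ
        _ ≤ _ := by
            rw [div_mul_eq_mul_div, le_div_iff₀ (by positivity)]
            gcongr
    have h3 : 0 ≤ K * |θ| ^ ((2 * n : ℕ) + α) := by positivity
    have := abs_sub (P θ * |θ| ^ α) (Q θ * |2 * Real.sin (θ / 2)| ^ α)
    linarith

/-- At θ = 2πωh the bound is of size h^(2n+α)|ω|^(2n+α), and the prefactor h^(-α) leaves h^(2n). The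
rest is a fixed integral, so the constant precedes h. -/
lemma error_bound {α : ℝ} {n : ℕ} {φ : ℝ → ℂ}
    (hφ : Integrable fun ω => ((|ω| ^ ((2 * n : ℕ) + α) : ℝ) : ℂ) * φ ω) {P Q : ℝ → ℝ} {C : ℝ}
    (hC : ∀ θ : ℝ, |P θ * |θ| ^ α - Q θ * |2 * Real.sin (θ / 2)| ^ α| ≤
      C * |θ| ^ ((2 * n : ℕ) + α)) :
    ∃ C', ∀ h : ℝ, 0 < h → ∀ w : ℝ → ℝ, IsFourierInt (fun ω =>
      ((P (2 * Real.pi * ω * h) * -|2 * Real.pi * ω| ^ α - Q (2 * Real.pi * ω * h) *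
        -(|2 * Real.sin (Real.pi * ω * h)| ^ α / h ^ α) : ℝ) : ℂ) * φ ω) w →
      ∀ x, |w x| ≤ C' * h ^ (2 * n) := by
  refine ⟨C * (2 * Real.pi) ^ ((2 * n : ℕ) + α) *
    ∫ ω, ‖((|ω| ^ ((2 * n : ℕ) + α) : ℝ) : ℂ) * φ ω‖, fun h hh w hw x => ?_⟩
  refine (hw.abs_le x).trans ?_
  rw [mul_right_comm, ← integral_const_mul]
  refine integral_mono hw.1.norm (hφ.norm.const_mul _) fun ω => ?_
  have hha : 0 < h ^ α := by positivity
  have e1 : |2 * Real.pi * ω| ^ α = |2 * Real.pi * ω * h| ^ α / h ^ α := by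
    rw [abs_mul _ h, abs_of_pos hh, Real.mul_rpow (abs_nonneg _) hh.le, mul_div_cancel_right₀ _ hha.ne']
  have e2 : Real.pi * ω * h = 2 * Real.pi * ω * h / 2 := by ring
  have e3 : P (2 * Real.pi * ω * h) * -|2 * Real.pi * ω| ^ α - Q (2 * Real.pi * ω * h) *
        -(|2 * Real.sin (Real.pi * ω * h)| ^ α / h ^ α) =
      -(P (2 * Real.pi * ω * h) * |2 * Real.pi * ω * h| ^ α - Q (2 * Real.pi * ω * h) *
        |2 * Real.sin (2 * Real.pi * ω * h / 2)| ^ α) / h ^ α := by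
    rw [e1, e2]; ring
  have e4 : |2 * Real.pi * ω * h| ^ ((2 * n : ℕ) + α) =
      (2 * Real.pi) ^ ((2 * n : ℕ) + α) * |ω| ^ ((2 * n : ℕ) + α) * (h ^ (2 * n) * h ^ α) := by
    rw [abs_mul _ h, abs_mul _ ω, abs_of_pos hh, abs_of_pos Real.two_pi_pos,
      Real.mul_rpow (by positivity) hh.le, Real.mul_rpow (by positivity) (by positivity),
      Real.rpow_add hh, Real.rpow_natCast]
  simp only
  rw [norm_mul, norm_mul, Complex.norm_real, Complex.norm_real, e3, Real.norm_eq_abs, abs_div,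
    abs_neg, abs_of_pos hha, Real.norm_eq_abs,
    abs_of_nonneg (by positivity : 0 ≤ |ω| ^ ((2 * n : ℕ) + α)), ← mul_assoc]
  refine mul_le_mul_of_nonneg_right ?_ (norm_nonneg _)
  rw [div_le_iff₀ hha]
  refine (hC _).trans (le_of_eq ?_)
  rw [e4]
  ring

open PowerSeries in
lemma compact_symbol_expansion {α : ℝ} {a : ℕ → ℝ} (ha : IsSincExpansion α a) {n : ℕ}
    (hn : 2 ≤ n) :
    ∃ K, 0 ≤ K ∧ ∀ᶠ θ : ℝ in 𝓝[≠] 0,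
      |(1 - compactCoeff α (n - 1) * (2 * Real.cos θ - 2) ^ (n - 1)) -
        (∑ l ∈ Finset.range (n - 1), compactCoeff α l * (2 * Real.cos θ - 2) ^ l) *
          |2 * Real.sin (θ / 2) / θ| ^ α| ≤ K * |θ| ^ (2 * n) := by
  obtain ⟨hA0, hA⟩ := ha.spec
  have hD := hasEvenExpansion_diffSymbolSeries
  have hexp := ((HasEvenExpansion.const 1).sub
    ((hD.pow (n - 1)).const_mul (compactCoeff α (n - 1)))).sub
    ((HasEvenExpansion.sum (Finset.range (n - 1)) fun l _ =>
      (hD.pow l).const_mul (compactCoeff α l)).mul (isSincExpansion_iff.1 ha))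
  refine hexp.bound (X_pow_dvd_iff.1 ?_)
  have h1 := sum_compactCoeff_dvd hA hA0 n
  -- The scheme applies b_{n-1} `δ_x^{2n-2}` to the Riesz derivative itself, so A = `mk a` is
  -- replaced by 1 in the last term. As A - 1 has no constant term, this costs only a multiple of
  -- X^n.
  have h2 : X ^ n ∣ diffSymbolSeries ^ (n - 1) * (mk a - 1) := by
    have hn' : (X : ℝ⟦X⟧) ^ n = X ^ (n - 1) * X := by rw [← pow_succ]; congr 1; omega
    rw [hn']
    refine mul_dvd_mul (pow_dvd_pow_of_dvd ?_ _) (X_dvd_iff.2 ?_)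
    · rw [diffSymbolSeries]; exact (Dvd.intro _ rfl).neg_right
    · rw [map_sub, hA0, map_one, sub_self]
  have h3 := (h2.mul_left (C (compactCoeff α (n - 1)))).sub h1
  have hr : Finset.range n = Finset.range (n - 1 + 1) := by congr 1; omega
  rw [hr, Finset.sum_range_succ] at h3
  convert h3 using 1
  rw [map_one]
  ring

open PowerSeries in
lemma sinc_pow_expansion_order_two {α : ℝ} {a : ℕ → ℝ} (ha : IsSincExpansion α a) :
    ∃ K, 0 ≤ K ∧ ∀ᶠ θ : ℝ in 𝓝[≠] 0,
      |1 - 1 * |2 * Real.sin (θ / 2) / θ| ^ α| ≤ K * |θ| ^ (2 * 1) := by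
  obtain ⟨hA0, -⟩ := ha.spec
  have hexp := (HasEvenExpansion.const 1).sub (isSincExpansion_iff.1 ha)
  simp only [one_mul]
  refine hexp.bound fun m hm => ?_
  obtain rfl : m = 0 := by omega
  rw [coeff_zero_eq_constantCoeff_apply, map_sub, hA0]
  simp

/-- Fourier-side description of the data `u` of the theorem: the transform of `u` decays like
`|ω| ^ (-p)`. -/
structure DecayingFourier (p : ℝ) (u : ℝ → ℝ) : Prop where
  continuous : Continuous u
  integrable : Integrable u
  decay : ∃ K, 0 ≤ K ∧ ∀ ω, ‖fourierReal u ω‖ ≤ K * (1 + |ω|) ^ (-p)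

namespace DecayingFourier

variable {p : ℝ} {u : ℝ → ℝ}

lemma integrable_rpow_mul (hu : DecayingFourier p u) {r : ℝ} (hr0 : 0 ≤ r) (hr : r < p - 1) :
    Integrable fun ω => ((|ω| ^ r : ℝ) : ℂ) * fourierReal u ω := by
  obtain ⟨K, -, hK⟩ := hu.decay
  exact integrable_abs_rpow_mul_of_decay (continuous_fourierReal hu.integrable) hK hr0 hr

lemma isFourierInt (hu : DecayingFourier p u) (hp : 1 < p) :
    IsFourierInt (fourierReal u) u := by
  refine isFourierInt_fourierReal hu.continuous hu.integrable ?_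
  simpa using hu.integrable_rpow_mul le_rfl (by linarith)

lemma integrable_rpow_mul' (hu : DecayingFourier p u) (hp : 1 < p) {r : ℝ} (hr0 : -1 < r)
    (hr : r < p - 1) : Integrable fun ω => ((|ω| ^ r : ℝ) : ℂ) * fourierReal u ω := by
  rcases le_total 0 r with h | h
  · exact hu.integrable_rpow_mul h hr
  · exact integrable_abs_rpow_mul (hu.isFourierInt hp).1 (norm_fourier_le _) hr0 h

lemma integrable_potential (hu : DecayingFourier p u) (hp : 1 < p) {s : ℝ} (hs0 : 0 ≤ s)
    (hs1 : s < 1) (x : ℝ) :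
    Integrable fun y => ((|y| ^ (-s) : ℝ) : ℂ) * (u (x - y) : ℂ) := by
  obtain ⟨M, hM⟩ := (hu.isFourierInt hp).mem_boundedFun
  refine integrable_abs_rpow_mul (f := fun y => (u (x - y) : ℂ))
    (hu.integrable.comp_sub_left x).ofReal (M := M) (fun y => ?_) (by linarith) (by linarith)
  rw [Complex.norm_real]
  exact hM _

lemma integrable_singular (hu : DecayingFourier p u) (hp : 1 < p) {α : ℝ} (hα1 : 1 < α)
    (hα2 : α < 2) (x : ℝ) : Integrable fun η : ℝ => u η / |x - η| ^ (α - 1) := by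
  have h := ((hu.integrable_potential hp (s := α - 1) (by linarith) (by linarith)
    x).comp_sub_left x).re
  refine h.congr (Eventually.of_forall fun η => ?_)
  simp only [sub_sub_cancel]
  rw [← Complex.ofReal_mul]
  simp only [RCLike.re_to_complex, Complex.ofReal_re]
  rw [Real.rpow_neg (abs_nonneg _), div_eq_inv_mul]

lemma isFourierInt_singularIntegral (hu : DecayingFourier p u) (hp : 2 < p) {α : ℝ}
    (hα1 : 1 < α) (hα2 : α < 2) :
    IsFourierInt (fun ω => ((Real.pi ^ (-((1 - (α - 1)) / 2)) * Real.Gamma ((1 - (α - 1)) / 2) /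
        (Real.pi ^ (-((α - 1) / 2)) * Real.Gamma ((α - 1) / 2)) : ℝ) : ℂ) *
      (((|ω| ^ (α - 1 - 1) : ℝ) : ℂ) * fourierReal u ω)) (singularIntegral α u) := by
  have h2 := hu.integrable_rpow_mul' (r := α - 1 - 1) (by linarith) (by linarith) (by linarith)
  refine ⟨h2.const_mul _, fun x => ?_⟩
  have h1 := hu.integrable_potential (by linarith) (s := α - 1) (by linarith) (by linarith) x
  have h := (hu.isFourierInt (by linarith)).riesz_potential (s := α - 1) (by linarith)
    (by linarith) x h1 (hu.integrable.comp_sub_left x).ofReal.1 h2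
  have e : ∫ y, ((|y| ^ (-(α - 1)) : ℝ) : ℂ) * (u (x - y) : ℂ) = (singularIntegral α u x : ℂ) := by
    rw [singularIntegral, ← integral_sub_left_eq_self _ _ x, ← integral_complex_ofReal]
    refine integral_congr_ae (Eventually.of_forall fun y => ?_)
    simp only [sub_sub_cancel]
    rw [Real.rpow_neg (abs_nonneg _), div_eq_inv_mul, Complex.ofReal_mul]
  rw [e] at h
  have hc : (0 : ℝ) < Real.pi ^ (-((α - 1) / 2)) * Real.Gamma ((α - 1) / 2) := by
    have := Real.Gamma_pos_of_pos (by linarith : 0 < (α - 1) / 2)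
    have := Real.pi_pos
    positivity
  simp only [mul_left_comm (Complex.exp _) ((_ / _ : ℝ) : ℂ)]
  rw [integral_const_mul, Complex.ofReal_div, div_mul_eq_mul_div, ← h, mul_div_cancel_left₀]
  exact_mod_cast hc.ne'

lemma contDiff_singularIntegral (hu : DecayingFourier p u) (hp : 3 < p) {α : ℝ}
    (hα1 : 1 < α) (hα2 : α < 2) :
    ContDiff ℝ 2 (singularIntegral α u) ∧
      IsFourierInt (fun ω => ((-|2 * Real.pi * ω| ^ α : ℝ) : ℂ) * fourierReal u ω)
        (rieszDeriv α u) := by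
  have h := hu.isFourierInt_singularIntegral (by linarith) hα1 hα2
  -- At ω = 0 both sides are 0 by the convention for `rpow`, because j + α - 2 is never 0 when 1 < α
  -- < 2.
  have hpow : ∀ j : ℕ, j ≤ 2 → ∀ ω : ℝ, |ω| ^ j * |ω| ^ (α - 1 - 1) = |ω| ^ ((j : ℝ) + (α - 1 - 1)) := by
    intro j hj ω
    rcases eq_or_ne ω 0 with rfl | hω
    · have hj' : j = 0 ∨ j = 1 ∨ j = 2 := by omega
      rw [abs_zero, Real.zero_rpow (by linarith), mul_zero, Real.zero_rpow]
      rcases hj' with rfl | rfl | rfl <;> norm_num <;> linarith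
    · rw [Real.rpow_add (abs_pos.2 hω), Real.rpow_natCast]
  obtain ⟨hc, h2⟩ := h.iteratedDeriv_two fun j hj => by
    have hj' : (j : ℝ) ≤ 2 := by exact_mod_cast hj
    have hj0 : (0 : ℝ) ≤ j := by positivity
    have := (hu.integrable_rpow_mul' (r := (j : ℝ) + (α - 1 - 1)) (by linarith) (by linarith)
      (by linarith)).const_mul ((Real.pi ^ (-((1 - (α - 1)) / 2)) *
        Real.Gamma ((1 - (α - 1)) / 2) /
        (Real.pi ^ (-((α - 1) / 2)) * Real.Gamma ((α - 1) / 2)) : ℝ) : ℂ)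
    refine this.congr (Eventually.of_forall fun ω => ?_)
    simp only
    rw [← hpow j hj, Complex.ofReal_mul]
    ring
  refine ⟨hc, ?_⟩
  refine (h2.const_mul (-(kappa α / Real.Gamma (2 - α)))).congr fun ω => ?_
  have hc := riesz_constant hα1 hα2
  have e1 : |2 * Real.pi * ω| ^ α = (2 * Real.pi) ^ α * (ω ^ 2 * |ω| ^ (α - 1 - 1)) := by
    rw [abs_mul, abs_of_pos Real.two_pi_pos, Real.mul_rpow Real.two_pi_pos.le (abs_nonneg _),
      ← sq_abs, hpow 2 le_rfl]
    congr 2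
    push_cast
    ring
  rw [e1, ← mul_assoc, ← mul_assoc, ← mul_assoc]
  congr 1
  rw [← Complex.ofReal_mul, ← Complex.ofReal_mul, ← Complex.ofReal_mul, Complex.ofReal_inj]
  linear_combination (ω ^ 2 * |ω| ^ (α - 1 - 1)) * hc

end DecayingFourier

lemma abs_two_mul_cos_sub_two_pow_le (θ : ℝ) (l : ℕ) : |(2 * Real.cos θ - 2) ^ l| ≤ 4 ^ l := by
  rw [abs_pow]
  refine pow_le_pow_left₀ (abs_nonneg _) ?_ l
  rw [abs_le]
  constructor <;> linarith [Real.neg_one_le_cos θ, Real.cos_le_one θ]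

lemma IsFourierInt.neg_fracDiff_div {α : ℝ} (hα1 : 1 < α) (hα2 : α < 2) {φ : ℝ → ℂ} {u : ℝ → ℝ}
    (hu : IsFourierInt φ u) (h : ℝ) :
    IsFourierInt (fun ω =>
      ((-(|2 * Real.sin (Real.pi * ω * h)| ^ α / h ^ α) : ℝ) : ℂ) * φ ω)
      fun y => -(RieszCompact.fracDiff α h u y / h ^ α) := by
  have h1 := ((hu.fracDiff hα1 hα2 h).const_mul (-(1 / h ^ α))).congr (ψ := fun ω =>
      ((-(|2 * Real.sin (Real.pi * ω * h)| ^ α / h ^ α) : ℝ) : ℂ) * φ ω) fun ω => by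
    rw [← mul_assoc, ← Complex.ofReal_mul]
    congr 2
    ring
  convert h1 using 2
  ring

lemma IsFourierInt.explicitOp {φ : ℝ → ℂ} {v : ℝ → ℝ} (hv : IsFourierInt φ v) (n : ℕ)
    (b : ℕ → ℝ) (h : ℝ) :
    IsFourierInt (fun ω => ((∑ l ∈ Finset.range (n - 1),
      b l * (2 * Real.cos (2 * Real.pi * ω * h) - 2) ^ l : ℝ) : ℂ) * φ ω)
      (RieszCompact.explicitOp n b h v) := by
  refine (IsFourierInt.sum (Finset.range (n - 1)) fun l _ =>
    (hv.centralDiff h l).const_mul (b l)).congr fun ω => ?_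
  rw [Complex.ofReal_sum, Finset.sum_mul]
  refine Finset.sum_congr rfl fun l _ => ?_
  rw [← mul_assoc, ← Complex.ofReal_mul]

lemma IsFourierInt.compactOp {φ : ℝ → ℂ} {v : ℝ → ℝ} (hv : IsFourierInt φ v) (n : ℕ)
    (b : ℕ → ℝ) (h : ℝ) :
    IsFourierInt (fun ω => ((1 - b (n - 1) *
      (2 * Real.cos (2 * Real.pi * ω * h) - 2) ^ (n - 1) : ℝ) : ℂ) * φ ω)
      (RieszCompact.compactOp n b h v) := by
  have e : RieszCompact.compactOp n b h v = fun x => v x - b (n - 1) * RieszCompact.centralDiff h (n - 1) v x :=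
    funext fun x => compactOp_apply n b h v x
  rw [e]
  refine (hv.sub ((hv.centralDiff h (n - 1)).const_mul (b (n - 1)))).congr fun ω => ?_
  push_cast
  ring

end RieszCompact

end

theorem theorem2 (α : ℝ) (hα1 : 1 < α) (hα2 : α < 2) :
    -- the expansion of `|2 sin(θ/2)/θ|^α` determines the `a_p`
    (∃! a : ℕ → ℝ, IsSincExpansion α a) ∧
    ∀ a : ℕ → ℝ, IsSincExpansion α a →
      (a 0 = 1 ∧ a 1 = -α / 24 ∧ a 2 = (1 / 1920 + (α - 1) / 1152) * α ∧
        a 3 = -(1 / 322560 + (α - 1) / 46080 + (α - 1) * (α - 2) / 82944) * α) ∧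
      ∃ b : ℕ → ℝ,
        -- the matching equation has exactly one solution `b_0, …, b_{n-1}`
        (∀ n : ℕ, 2 ≤ n → ∀ c : ℕ → ℝ,
          IsCompactCoeff a n c ↔ ∀ l : ℕ, l < n → c l = b l) ∧
        -- the coefficients of the formulas of orders 4, 6, 8, 10
        (b 0 = 1 ∧ b 1 = -α / 24 ∧ b 2 = (11 / 2880 + α / 1152) * α ∧
          b 3 = -(191 / 362880 + 11 * α / 69120 + α ^ 2 / 82944) * α ∧
          b 4 = (2497 / 29030400 + 10181 * α / 348364800 + 11 * α ^ 2 / 3317760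
            + α ^ 3 / 7962624) * α) ∧
        -- `δ_x^0 - b_{n-1} δ_x^{2n-2}` is invertible
        (∀ n : ℕ, 2 ≤ n → ∀ h : ℝ, 0 < h →
          Set.BijOn (compactOp n b h) boundedFun boundedFun) ∧
        ∀ n : ℕ, 1 ≤ n → ∀ u : ℝ → ℝ,
          ContDiff ℝ ((⌊α⌋₊ + 2 * n + 1 : ℕ) : WithTop ℕ∞) u →
          Differentiable ℝ (iteratedDeriv (⌊α⌋₊ + 2 * n + 1) u) →
          (∀ k : ℕ, k ≤ ⌊α⌋₊ + 2 * n + 2 →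
            MeasureTheory.Integrable (iteratedDeriv k u) MeasureTheory.volume) →
          -- the Riesz derivative and the fractional difference are well defined
          (∀ x : ℝ, MeasureTheory.Integrable
            (fun η : ℝ => u η / |x - η| ^ (α - 1)) MeasureTheory.volume) ∧
          ContDiff ℝ 2 (singularIntegral α u) ∧
          (∀ h : ℝ, 0 < h → ∀ x : ℝ,
            Summable (fun k : ℤ => gCoeff α k * u (x - (k : ℝ) * h))) ∧
          -- for `n = 1` the formula is the second-order one
          (n = 1 → ∃ C : ℝ, ∀ h : ℝ, 0 < h → ∀ x : ℝ,
            |rieszDeriv α u x - -(fracDiff α h u x / h ^ α)| ≤ C * h ^ (2 * n)) ∧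
          (2 ≤ n →
            (∀ h : ℝ, 0 < h →
              explicitOp n b h (fun y => -(fracDiff α h u y / h ^ α)) ∈ boundedFun) ∧
            ∃ C : ℝ, ∀ h : ℝ, 0 < h → ∀ x : ℝ,
              |rieszDeriv α u x -
                compactInv n b h
                  (explicitOp n b h (fun y => -(fracDiff α h u y / h ^ α))) x|
                ≤ C * h ^ (2 * n)) := by
  refine ⟨existsUnique_isSincExpansion α, fun a ha => ⟨ha.values, compactCoeff α,
    fun n hn c => isCompactCoeff_iff ha hn c, compactCoeff_values α, fun n hn h _ =>
      compactOp_bijOn (abs_compactCoeff_mul_lt_one (by linarith) hα2.le (by omega)), ?_⟩⟩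
  intro n hn u hu hd hi
  have hfloor : ⌊α⌋₊ = 1 := by
    rw [Nat.floor_eq_iff (by linarith)]
    norm_num
    exact ⟨hα1.le, hα2⟩
  rw [hfloor] at hu hd hi
  have hn' : (1 : ℝ) ≤ n := by exact_mod_cast hn
  -- With [α] = 1, the number of integrable derivatives is 2n + 3, which is the decay exponent of
  -- the transform.
  have hD : DecayingFourier (2 * n + 3) u := by
    refine ⟨hu.continuous, by simpa using hi 0 (by omega), ?_⟩
    obtain ⟨K, hK0, hK⟩ := norm_fourierReal_le hu hd hi
    refine ⟨K, hK0, fun ω => (hK ω).trans (le_of_eq ?_)⟩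
    push_cast
    ring_nf
  have hF := hD.isFourierInt (by linarith)
  obtain ⟨hc, hR⟩ := hD.contDiff_singularIntegral (by linarith) hα1 hα2
  -- Integrability needs 2n + α < (2n + 3) - 1, which is α < 2.
  have hint := hD.integrable_rpow_mul (r := (2 * n : ℕ) + α) (by positivity)
    (by push_cast; linarith)
  refine ⟨hD.integrable_singular (by linarith) hα1 hα2, hc,
    fun h _ x => summable_gCoeff_mul hα1 hα2 hF.mem_boundedFun h x, ?_, ?_⟩
  · rintro rfl
    obtain ⟨C, -, hC⟩ := symbol_bound (n := 1) (P := fun _ => 1) (Q := fun _ => 1) (M := 1) (L := 1)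
      (by linarith : 0 < α) (by simp) (by simp) (sinc_pow_expansion_order_two ha)
    obtain ⟨C', hC'⟩ := error_bound hint hC
    refine ⟨C', fun h hh x => hC' h hh
      (fun y => rieszDeriv α u y - -(fracDiff α h u y / h ^ α)) ?_ x⟩
    refine (hR.sub (hF.neg_fracDiff_div hα1 hα2 h)).congr fun ω => ?_
    push_cast
    ring
  · intro hn2
    have hexp : ∀ h, IsFourierInt _
        (explicitOp n (compactCoeff α) h (fun y => -(fracDiff α h u y / h ^ α))) :=
      fun h => (hF.neg_fracDiff_div hα1 hα2 h).explicitOp n (compactCoeff α) h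
    refine ⟨fun h _ => (hexp h).mem_boundedFun, ?_⟩
    obtain ⟨C, -, hC⟩ := symbol_bound (n := n) (by linarith : 0 < α)
      (P := fun θ => 1 - compactCoeff α (n - 1) * (2 * Real.cos θ - 2) ^ (n - 1))
      (Q := fun θ => ∑ l ∈ Finset.range (n - 1), compactCoeff α l * (2 * Real.cos θ - 2) ^ l)
      (M := 1 + |compactCoeff α (n - 1)| * 4 ^ (n - 1))
      (L := ∑ l ∈ Finset.range (n - 1), |compactCoeff α l| * 4 ^ l)
      (fun θ => by
        refine (abs_sub _ _).trans ?_
        rw [abs_one, abs_mul]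
        gcongr
        exact abs_two_mul_cos_sub_two_pow_le θ _)
      (fun θ => by
        refine (Finset.abs_sum_le_sum_abs _ _).trans (Finset.sum_le_sum fun l _ => ?_)
        rw [abs_mul]
        gcongr
        exact abs_two_mul_cos_sub_two_pow_le θ _)
      (compact_symbol_expansion ha hn2)
    obtain ⟨C', hC'⟩ := error_bound hint hC
    have hb := abs_compactCoeff_mul_lt_one (by linarith : 0 ≤ α) hα2.le (by omega : n - 1 ≠ 0)
    refine ⟨C' / (1 - |compactCoeff α (n - 1)| * 4 ^ (n - 1)), fun h hh x => ?_⟩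
    rw [div_mul_eq_mul_div]
    -- The Riesz derivative nearly solves the compact equation: its residual is a Fourier integral
    -- covered by `hC'`, and stability of the inverse bounds the error.
    refine abs_sub_compactInv_le hb hR.mem_boundedFun (hexp h).mem_boundedFun (fun y => ?_) x
    refine hC' h hh (fun y => compactOp n (compactCoeff α) h (rieszDeriv α u) y -
      explicitOp n (compactCoeff α) h (fun y => -(fracDiff α h u y / h ^ α)) y) ?_ y
    refine ((hR.compactOp n (compactCoeff α) h).sub (hexp h)).congr fun ω => ?_
    push_cast
    ring
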